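/- Let $\mathbb H$ be the real quaternions with units $i,j,k$, let $0\le\theta<2\pi$ and $u\in\mathbb H$. Put $\psi=(\psi_0,\psi_1,\psi_2,\psi_3)=(1,\,i,\,ie^{i\theta}j,\,e^{i\theta}j)$, an orthonormal basis of $\mathbb H\cong\mathbb R^4$. Points of $\mathbb H$ are written $z=\sum_k x_k\psi_k$ with $x_k\in\mathbb R$, and $\partial/\partial x_k$ are the partial derivatives in these coordinates. Set $\langle x,y\rangle_\theta=\sum_k x_ky_k$. For an open set $\Omega\subset\mathbb H$ and $f\in C^1(\Omega,\mathbb H)$ put $${}^\theta_u\mathcal D[f]=\sum_k\psi_k\frac{\partial f}{\partial x_k}+uf,\qquad {}^\theta\mathcal D_{r,u}[f]=\sum_k\frac{\partial f}{\partial x_k}\psi_k+fu .$$ The function $f$ is called left (right) $(\theta,u)$-hyperholomorphic on $\Omega$ if $f\in C^1(\Omega,\mathbb H)$ and ${}^\theta_u\mathcal D[f]=0$ (respectively ${}^\theta\mathcal D_{r,u}[f]=0$) on $\Omega$. For $w=w_1+ie^{i\theta}j\,w_2\ne0$ with $w_1,w_2\in\mathbb C$ let $$K_\theta(w)=\frac{1}{2\pi^2|w|^4}\left(\overline{w_1}-ie^{i\theta}\,\overline{w_2}\,j\right)=\frac{\overline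 w}{2\pi^2|w|^4},\qquad K^\theta_u(w)=e^{\langle u,w\rangle_\theta}K_\theta(w).$$ Let $\mu$ be Lebesgue measure on $\mathbb H$. For a bounded domain $\Omega$ with $C^1$ boundary (locally $\Omega=\{\rho<0\}$ with $\rho$ of class $C^1$ and $\nabla\rho\neq0$), with outward unit normal $n=\sum_kn_k\psi_k$ and three-dimensional area measure $dS$ on $\partial\Omega$, let $\sigma^\theta_\zeta=\sum_kn_k(\zeta)\psi_k\,dS_\zeta$ be the $\mathbb H$-valued area form of $\partial\Omega$. 1. Let $\Omega\subset\mathbb H$ be a bounded domain with $C^1$ boundary, let $f$ be left $(\theta,u)$-hyperholomorphic on $\Omega$ and $g$ right $(\theta,u)$-hyperholomorphic on $\Omega$, both continuous on $\overline\Omega$. Then, for every $z\notin\partial\Omega$, the following integrand is integrable over $\partial\Omega$ and $$\int_{\partial\Omega}\left(K^\theta_u(\zeta-z)\,\sigma^\theta_\zeta\,f(\zeta)+g(\zeta)\,\sigma^\theta_\zeta\,K^\theta_u(\zeta-z)\right)=\begin{cases}f(z)+g(z),& z\in\Omega,\\ 0,& z\in\mathbb H\setminus\overline\Omega.\end{cases}$$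 2. For every $\epsilon>0$ there is a constant $k_\epsilon>0$, depending only on $\epsilon$, $\theta$ and $u$, such that for every bounded domain $\Omega\subset\mathbb H$ and every $z\in\Omega$ with $\overline{\mathbb B(z,\epsilon)}\subset\Omega$, $$|f(z)|\le k_\epsilon\left(\int_{\mathbb B(z,\epsilon)}|f(\zeta)|^2\,d\mu_\zeta\right)^{1/2}$$ for all left $(\theta,u)$-hyperholomorphic $f$ on $\Omega$. -/

import Mathlib

open MeasureTheory
open scoped Quaternion Topology

noncomputable section

namespace ThetaHyper

/-- The Borel sets of the quaternions. The volume on `ℍ[ℝ]` is then the Lebesgue measure of the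
four-dimensional Euclidean space. -/
instance : MeasurableSpace ℍ[ℝ] := borel ℍ[ℝ]

instance : BorelSpace ℍ[ℝ] := ⟨rfl⟩

/-- The imaginary units `i` and `j`, and the quaternion `e^{iθ} = cos θ + i sin θ`. -/
def qi : ℍ[ℝ] := ⟨0, 1, 0, 0⟩

def qj : ℍ[ℝ] := ⟨0, 0, 1, 0⟩

def qexp (θ : ℝ) : ℍ[ℝ] := ((Complex.exp (θ * Complex.I) : ℂ) : ℍ[ℝ])

theorem qi_parts : qi.re = 0 ∧ qi.imI = 1 ∧ qi.imJ = 0 ∧ qi.imK = 0 := ⟨rfl, rfl, rfl, rfl⟩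

theorem qj_parts : qj.re = 0 ∧ qj.imI = 0 ∧ qj.imJ = 1 ∧ qj.imK = 0 := ⟨rfl, rfl, rfl, rfl⟩

theorem qexp_parts (θ : ℝ) : (qexp θ).re = Real.cos θ ∧ (qexp θ).imI = Real.sin θ ∧
    (qexp θ).imJ = 0 ∧ (qexp θ).imK = 0 := by
  simp [qexp, Complex.exp_ofReal_mul_I_re, Complex.exp_ofReal_mul_I_im]

/-- The structural set `ψ = (1, i, i e^{iθ} j, e^{iθ} j)`. -/
def psi (θ : ℝ) : Fin 4 → ℍ[ℝ] :=
  ![1, qi, qi * qexp θ * qj, qexp θ * qj]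

/-- The real coordinates `x₀, x₁, x₂, x₃` of `x = x₀ + x₁ i + x₂ i e^{iθ} j + x₃ e^{iθ} j`
(see `sum_coord_smul_psi`). -/
def coord (θ : ℝ) (x : ℍ[ℝ]) (k : Fin 4) : ℝ := inner ℝ (psi θ k) x

theorem coord_eq (θ : ℝ) (x : ℍ[ℝ]) : coord θ x = ![x.re, x.imI,
    -Real.sin θ * x.imJ + Real.cos θ * x.imK, Real.cos θ * x.imJ + Real.sin θ * x.imK] := by
  funext k
  fin_cases k <;> simp [coord, psi, Quaternion.inner_def, qi_parts, qj_parts, qexp_parts]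

theorem sum_coord_smul_psi (θ : ℝ) (x : ℍ[ℝ]) : ∑ k, coord θ x k • psi θ k = x := by
  have h := Real.sin_sq_add_cos_sq θ
  ext <;> simp [Fin.sum_univ_four, coord_eq, psi, qi_parts, qj_parts, qexp_parts]
  · linear_combination x.imJ * h
  · linear_combination x.imK * h

/-- `⟨x, y⟩_θ = ∑ x_k y_k` in the coordinates with respect to `ψ`. -/
def thetaInner (θ : ℝ) (x y : ℍ[ℝ]) : ℝ := ∑ k, coord θ x k * coord θ y k

/-- `∂f / ∂x_k` at `z`, where `z = x₀ + x₁ i + x₂ i e^{iθ} j + x₃ e^{iθ} j`. -/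
def partialD (θ : ℝ) (k : Fin 4) (f : ℍ[ℝ] → ℍ[ℝ]) (z : ℍ[ℝ]) : ℍ[ℝ] :=
  fderiv ℝ f z (psi θ k)

/-- The left operator `f ↦ ∑ ψ_k ∂f/∂x_k + u f`. -/
def leftOp (θ : ℝ) (u : ℍ[ℝ]) (f : ℍ[ℝ] → ℍ[ℝ]) (z : ℍ[ℝ]) : ℍ[ℝ] :=
  ∑ k, psi θ k * partialD θ k f z + u * f z

/-- The right operator `f ↦ ∑ (∂f/∂x_k) ψ_k + f u`. -/
def rightOp (θ : ℝ) (u : ℍ[ℝ]) (f : ℍ[ℝ] → ℍ[ℝ]) (z : ℍ[ℝ]) : ℍ[ℝ] :=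
  ∑ k, partialD θ k f z * psi θ k + f z * u

/-- Left `(θ, u)`-hyperholomorphic functions on an open set `Ω`: `C¹` and in the kernel of the
left operator. -/
def LeftHyperholomorphic (θ : ℝ) (u : ℍ[ℝ]) (Ω : Set ℍ[ℝ]) (f : ℍ[ℝ] → ℍ[ℝ]) : Prop :=
  ContDiffOn ℝ 1 f Ω ∧ ∀ z ∈ Ω, leftOp θ u f z = 0

/-- Right `(θ, u)`-hyperholomorphic functions on an open set `Ω`. -/
def RightHyperholomorphic (θ : ℝ) (u : ℍ[ℝ]) (Ω : Set ℍ[ℝ]) (g : ℍ[ℝ] → ℍ[ℝ]) : Prop :=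
  ContDiffOn ℝ 1 g Ω ∧ ∀ z ∈ Ω, rightOp θ u g z = 0

/-- The complex coordinates `w₁ = x₀ + x₁ i` and `w₂ = x₂ + x₃ i` of `w = w₁ + i e^{iθ} j w₂`. -/
def zCoord₁ (θ : ℝ) (w : ℍ[ℝ]) : ℂ := ⟨coord θ w 0, coord θ w 1⟩

def zCoord₂ (θ : ℝ) (w : ℍ[ℝ]) : ℂ := ⟨coord θ w 2, coord θ w 3⟩

/-- The Cauchy kernel
`K_θ(w) = (2π² |w|⁴)⁻¹ (conj w₁ - i e^{iθ} (conj w₂) j)`, that is `conj w / (2π² |w|⁴)`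
(see `cauchyKernel_eq`), the fundamental solution of `∑ ψ_k ∂/∂x_k`. -/
def cauchyKernel (θ : ℝ) (w : ℍ[ℝ]) : ℍ[ℝ] :=
  (1 / (2 * Real.pi ^ 2 * ‖w‖ ^ 4)) •
    (((star (zCoord₁ θ w) : ℂ) : ℍ[ℝ]) - qi * qexp θ * ((star (zCoord₂ θ w) : ℂ) : ℍ[ℝ]) * qj)

theorem cauchyKernel_eq (θ : ℝ) (w : ℍ[ℝ]) :
    cauchyKernel θ w = (1 / (2 * Real.pi ^ 2 * ‖w‖ ^ 4)) • star w := by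
  have h := Real.sin_sq_add_cos_sq θ
  unfold cauchyKernel
  congr 1
  ext <;> simp [zCoord₁, zCoord₂, coord_eq, qi_parts, qj_parts, qexp_parts]
  · linear_combination -w.imJ * h
  · linear_combination -w.imK * h

/-- The kernel `K_u^θ(w) = e^{⟨u, w⟩_θ} K_θ(w)`. -/
def cauchyKernelU (θ : ℝ) (u w : ℍ[ℝ]) : ℍ[ℝ] :=
  Real.exp (thetaInner θ u w) • cauchyKernel θ w

/-- `ρ` is a `C¹` function near `p` with nonzero derivative at `p`, and `Ω` is `{ρ < 0}` near
`p`. -/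
def IsLocalDefiningFunction (Ω : Set ℍ[ℝ]) (p : ℍ[ℝ]) (ρ : ℍ[ℝ] → ℝ) : Prop :=
  ContDiffAt ℝ 1 ρ p ∧ fderiv ℝ ρ p ≠ 0 ∧ ∀ᶠ x in 𝓝 p, (x ∈ Ω ↔ ρ x < 0)

/-- The boundary of `Ω` is a `C¹` hypersurface, with `Ω` locally on one side of it. -/
def HasC1Boundary (Ω : Set ℍ[ℝ]) : Prop :=
  ∀ p ∈ frontier Ω, ∃ ρ, IsLocalDefiningFunction Ω p ρ

open Classical in
/-- The outward unit normal `∇ρ(p) / |∇ρ(p)|` of `Ω` at a boundary point `p`. It does not depend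
on the local defining function `ρ` (see `outwardNormal_eq`). -/
def outwardNormal (Ω : Set ℍ[ℝ]) (p : ℍ[ℝ]) : ℍ[ℝ] :=
  if h : ∃ ρ, IsLocalDefiningFunction Ω p ρ then
    ‖gradient h.choose p‖⁻¹ • gradient h.choose p
  else 0

theorem IsLocalDefiningFunction.eq_zero {Ω : Set ℍ[ℝ]} {p : ℍ[ℝ]} {ρ : ℍ[ℝ] → ℝ}
    (h : IsLocalDefiningFunction Ω p ρ) (hp : p ∈ frontier Ω) : ρ p = 0 := by
  obtain ⟨h1, -, h3⟩ := h
  have hc : Filter.Tendsto ρ (𝓝 p) (𝓝 (ρ p)) := h1.continuousAt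
  rw [frontier_eq_closure_inter_closure] at hp
  apply le_antisymm
  · by_contra! hlt
    have := (mem_closure_iff_frequently.1 hp.1).and_eventually
      (h3.and (hc.eventually (lt_mem_nhds hlt)))
    obtain ⟨x, hx, hx2, hx3⟩ := this.exists
    exact absurd (hx2.1 hx) (not_lt.2 hx3.le)
  · by_contra! hlt
    have := (mem_closure_iff_frequently.1 hp.2).and_eventually
      (h3.and (hc.eventually (gt_mem_nhds hlt)))
    obtain ⟨x, hx, hx2, hx3⟩ := this.exists
    exact hx (hx2.2 hx3)

theorem IsLocalDefiningFunction.inner_nonpos {Ω : Set ℍ[ℝ]} {p : ℍ[ℝ]} {ρ τ : ℍ[ℝ] → ℝ}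
    (hρ : IsLocalDefiningFunction Ω p ρ) (hτ : IsLocalDefiningFunction Ω p τ)
    (hp : p ∈ frontier Ω) (v : ℍ[ℝ]) (hv : inner ℝ (gradient ρ p) v < 0) :
    inner ℝ (gradient τ p) v ≤ 0 := by
  have key : ∀ σ : ℍ[ℝ] → ℝ, IsLocalDefiningFunction Ω p σ →
      HasDerivAt (fun t : ℝ => σ (p + t • v)) (inner ℝ (gradient σ p) v) 0 := by
    intro σ hσ
    have hd : DifferentiableAt ℝ σ p := hσ.1.differentiableAt (by norm_num)
    have h1 : HasFDerivAt σ (fderiv ℝ σ p) (p + (0 : ℝ) • v) := by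
      simpa using hd.hasFDerivAt
    have h2 : HasDerivAt (fun t : ℝ => p + t • v) v 0 := by
      simpa using ((hasDerivAt_id (0 : ℝ)).smul_const v).const_add p
    have h3 := h1.comp_hasDerivAt (0 : ℝ) h2
    have h4 : inner ℝ (gradient σ p) v = fderiv ℝ σ p v := by
      simp [gradient]
    rw [h4]
    exact h3
  by_contra! hlt
  have hline : Filter.Tendsto (fun t : ℝ => p + t • v) (𝓝[>] 0) (𝓝 p) := by
    have : Continuous (fun t : ℝ => p + t • v) := by fun_prop
    have := (this.tendsto 0).mono_left (nhdsWithin_le_nhds (s := Set.Ioi (0 : ℝ)))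
    simpa using this
  have e1 : ∀ᶠ t in 𝓝[>] (0 : ℝ), ρ (p + t • v) < 0 := by
    have := (hasDerivAt_iff_tendsto_slope.1 (key ρ hρ)).mono_left
      (nhdsWithin_mono 0 (fun t (ht : 0 < t) => ht.ne'))
    filter_upwards [this.eventually (gt_mem_nhds hv), self_mem_nhdsWithin] with t ht ht0
    rw [slope_def_field] at ht
    simp only [zero_smul, add_zero, hρ.eq_zero hp, sub_zero] at ht
    have ht0' : (0 : ℝ) < t := ht0
    by_contra! hc
    exact absurd ht (not_lt.2 (div_nonneg hc ht0'.le))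
  have e2 : ∀ᶠ t in 𝓝[>] (0 : ℝ), 0 < τ (p + t • v) := by
    have := (hasDerivAt_iff_tendsto_slope.1 (key τ hτ)).mono_left
      (nhdsWithin_mono 0 (fun t (ht : 0 < t) => ht.ne'))
    filter_upwards [this.eventually (lt_mem_nhds hlt), self_mem_nhdsWithin] with t ht ht0
    rw [slope_def_field] at ht
    simp only [zero_smul, add_zero, hτ.eq_zero hp, sub_zero] at ht
    have ht0' : (0 : ℝ) < t := ht0
    by_contra! hc
    exact absurd ht (not_lt.2 (div_nonpos_of_nonpos_of_nonneg hc ht0'.le))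
  obtain ⟨t, h1, h2, h3, h4⟩ :=
    (e1.and (e2.and ((hline.eventually hρ.2.2).and (hline.eventually hτ.2.2)))).exists
  exact absurd (h4.1 (h3.2 h1)) (not_lt.2 h2.le)

theorem outwardNormal_eq {Ω : Set ℍ[ℝ]} {p : ℍ[ℝ]} {ρ : ℍ[ℝ] → ℝ}
    (h : IsLocalDefiningFunction Ω p ρ) (hp : p ∈ frontier Ω) :
    outwardNormal Ω p = ‖gradient ρ p‖⁻¹ • gradient ρ p := by
  have hex : ∃ ρ, IsLocalDefiningFunction Ω p ρ := ⟨ρ, h⟩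
  rw [outwardNormal, dif_pos hex]
  have h' := hex.choose_spec
  set τ := hex.choose
  have hne : ∀ σ : ℍ[ℝ] → ℝ, IsLocalDefiningFunction Ω p σ → 0 < ‖gradient σ p‖ := by
    intro σ hσ
    rw [norm_pos_iff]
    intro h0
    exact hσ.2.1 (by simpa [gradient] using h0)
  have ha := hne τ h'
  have hb := hne ρ h
  set a := gradient τ p
  set b := gradient ρ p
  have hab : -inner ℝ a b ≤ -(‖a‖ * ‖b‖) := by
    by_contra! hlt
    -- the vector `v = -‖b‖ a + ‖a‖ b - s a` violates the sign condition for a small `s`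
    have hv : ∀ s : ℝ, 0 < s →
        inner ℝ b (‖a‖ • b - ‖b‖ • a - s • a) ≤ 0 := by
      intro s hs
      apply h'.inner_nonpos h hp
      change inner ℝ a _ < 0
      rw [inner_sub_right, inner_sub_right, inner_smul_right, inner_smul_right, inner_smul_right,
        real_inner_self_eq_norm_sq]
      have := real_inner_le_norm a b
      have h5 : ‖a‖ * inner ℝ a b ≤ ‖a‖ * (‖a‖ * ‖b‖) := mul_le_mul_of_nonneg_left this ha.le
      have h6 : 0 < s * ‖a‖ ^ 2 := by positivity
      nlinarith
    have hlim : Filter.Tendsto (fun s : ℝ => inner ℝ b (‖a‖ • b - ‖b‖ • a - s • a)) (𝓝[>] 0)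
        (𝓝 (inner ℝ b (‖a‖ • b - ‖b‖ • a - (0 : ℝ) • a))) := by
      have : Continuous (fun s : ℝ => inner ℝ b (‖a‖ • b - ‖b‖ • a - s • a)) := by fun_prop
      exact (this.tendsto 0).mono_left nhdsWithin_le_nhds
    have h7 := le_of_tendsto hlim
      (Filter.eventually_of_mem self_mem_nhdsWithin (fun s hs => hv s hs))
    rw [zero_smul, sub_zero, inner_sub_right, inner_smul_right, inner_smul_right,
      real_inner_self_eq_norm_sq, real_inner_comm] at h7
    nlinarith
  have h8 : inner ℝ a b = ‖a‖ * ‖b‖ := le_antisymm (real_inner_le_norm a b) (by linarith)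
  rw [inner_eq_norm_mul_iff_real] at h8
  rw [inv_smul_eq_iff₀ ha.ne', smul_smul, mul_comm, ← smul_smul, eq_inv_smul_iff₀ hb.ne', h8]

/-- The density of the `ℍ`-valued area form `σ^θ = ∑ (-1)^k ψ_k dx_{[k]}` on the positively
oriented boundary of `Ω` with respect to the area measure: `∑ n_k ψ_k`, where `n` is the outward
unit normal and `dx_{[k]}` is `dx₀ ∧ dx₁ ∧ dx₂ ∧ dx₃` without the factor `dx_k`. -/
def areaForm (θ : ℝ) (Ω : Set ℍ[ℝ]) (ζ : ℍ[ℝ]) : ℍ[ℝ] :=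
  ∑ k, coord θ (outwardNormal Ω ζ) k • psi θ k

/-- The area measure on the boundary of `Ω`: three-dimensional Hausdorff measure, normalized as
usual so that it is the Lebesgue measure on three-dimensional subspaces. -/
def surfaceMeasure (Ω : Set ℍ[ℝ]) : Measure ℍ[ℝ] :=
  (Measure.euclideanHausdorffMeasure 3 : Measure ℍ[ℝ]).restrict (frontier Ω)

/-- The integrand `K_u^θ(ζ - z) σ^θ_ζ f(ζ) + g(ζ) σ^θ_ζ K_u^θ(ζ - z)` over the boundary of `Ω`. -/
def cauchyIntegrand (θ : ℝ) (u : ℍ[ℝ]) (Ω : Set ℍ[ℝ]) (f g : ℍ[ℝ] → ℍ[ℝ]) (z ζ : ℍ[ℝ]) :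
    ℍ[ℝ] :=
  cauchyKernelU θ u (ζ - z) * areaForm θ Ω ζ * f ζ +
    g ζ * areaForm θ Ω ζ * cauchyKernelU θ u (ζ - z)

/-- A bounded domain of `ℍ`: nonempty, open, connected and bounded. -/
def IsBoundedDomain (Ω : Set ℍ[ℝ]) : Prop :=
  IsOpen Ω ∧ IsConnected Ω ∧ Bornology.IsBounded Ω

end ThetaHyper

end

noncomputable section

namespace ThetaHyper

/-! Both statements follow from one identity: the Cauchy integral over the boundary equals a
weighted volume mean of `f + g`. Write `φ(ζ) = exp ⟨u, ζ - z⟩`. Since `∑ ⟨u, ψ_k⟩ ψ_k = u`, the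
functions `φ f` and `φ g` lie in the kernels of `∑ ψ_k ∂_k` and of its right version, so the term
with `u` disappears. Instead of excising a ball about `z`, the kernel `conj w / (2π²|w|⁴)` is
replaced for `|w| < r` by a `C¹` continuation `smoothedKernel`. Its left and right divergences are
the same real function `meanDensity r`, a probability density supported in the closed ball of radius
`r`. If the boundary stays at distance at least `r` from `z`, the boundary integral does not see the
change, and the divergence theorem turns it into `∫_Ω meanDensity r (ζ - z) φ(ζ) (f + g)(ζ)`
(`integral_cauchyIntegrand_eq`). For `z ∈ Ω` the left side is independent of `r`, and `r → 0` gives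
`f z + g z`. For `z` outside the closure, a small `r` makes the density vanish on `Ω`. With `g = 0`
on the ball of radius `ε` and `r = ε`, bounding the density and the weight and applying
Cauchy-Schwarz gives the L² estimate.

The divergence theorem for Hausdorff measure on a `C¹` boundary is obtained without an area formula.
Near a boundary point the boundary is a graph of slope at most `δ` over a hyperplane. Fubini in the
transversal direction reduces `∫_Ω ∂_v h` to boundary values integrated against the projected
measure, which differs from the surface measure by a factor `1 + O(δ²)` (`directional_estimate`). As
this error is quadratic, comparing the normal with a direction tilted by `τ` and dividing by `τ`
still leaves a small error for tangential derivatives (`tangential_estimate`). So Gauss-Green holds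
locally up to `η ∫ |h|`. These errors add up over a partition of unity without loss, whence exact
equality as `η → 0` (`gauss_green_of_contDiff`). Fields that are only continuous up to the boundary
are reached by shifting them locally inwards (`divergence_theorem_cutoff`). -/

variable {F : Type*} [NormedAddCommGroup F] [NormedSpace ℝ F]

/-! ### Orthogonal coordinates along a unit vector -/

/-- Fubini coordinates adapted to a unit vector. -/
theorem measurePreserving_add_smul_unit {v : ℍ[ℝ]} (hv : ‖v‖ = 1) :
    MeasurePreserving (fun q : (ℝ ∙ v)ᗮ × ℝ => (q.1 : ℍ[ℝ]) + q.2 • v) := by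
  have h1 : MeasurePreserving (LinearIsometryEquiv.toSpanUnitSingleton (𝕜 := ℝ) v hv) :=
    LinearIsometryEquiv.measurePreserving _
  have h2 := (MeasurePreserving.id (volume : Measure (ℝ ∙ v)ᗮ)).prod h1
  have h3 := ((ℝ ∙ v).orthogonalDecomposition.symm.measurePreserving).comp
    ((WithLp.volume_preserving_toLp (ℝ ∙ v) (ℝ ∙ v)ᗮ).comp (Measure.measurePreserving_swap.comp h2))
  convert! h3 using 1
  ext1 q
  simp [add_comm]

theorem orthogonalProjectionOnto_add_smul {v : ℍ[ℝ]} (y : (ℝ ∙ v)ᗮ) (t : ℝ) :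
    (ℝ ∙ v)ᗮ.orthogonalProjectionOnto ((y : ℍ[ℝ]) + t • v) = y := by
  rw [map_add, map_smul]
  have : (ℝ ∙ v)ᗮ.orthogonalProjectionOnto v = 0 := by
    exact Submodule.orthogonalProjectionOnto_orthogonalComplement_singleton_eq_zero v
  simp [this]

theorem orthogonalProjectionOnto_add_inner_smul {v : ℍ[ℝ]} (hv : ‖v‖ = 1) (x : ℍ[ℝ]) :
    ((ℝ ∙ v)ᗮ.orthogonalProjectionOnto x : ℍ[ℝ]) + (inner ℝ v x) • v = x := by
  have := Submodule.starProjection_add_starProjection_orthogonal (K := ℝ ∙ v) x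
  rw [Submodule.starProjection_unit_singleton ℝ hv] at this
  rw [add_comm]
  exact this

theorem norm_sq_eq_orthogonalProjectionOnto {v : ℍ[ℝ]} (hv : ‖v‖ = 1) (x : ℍ[ℝ]) :
    ‖x‖ ^ 2 = ‖(ℝ ∙ v)ᗮ.orthogonalProjectionOnto x‖ ^ 2 + (inner ℝ v x) ^ 2 := by
  have h := Submodule.norm_sq_eq_add_norm_sq_projection x (ℝ ∙ v)
  have h2 : ‖(ℝ ∙ v).orthogonalProjectionOnto x‖ = |inner ℝ v x| := by
    have := Submodule.starProjection_unit_singleton ℝ hv x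
    change ‖(ℝ ∙ v).starProjection x‖ = _
    rw [this, norm_smul, hv, mul_one, Real.norm_eq_abs]
  rw [h, h2, sq_abs, add_comm]

/-! ### Integration on the line and comparison of measures -/

/-- One-dimensional fundamental theorem of calculus on an initial piece of an interval. -/
theorem setIntegral_deriv_of_initial [CompleteSpace F] {h : ℝ → F} (hc : ContDiff ℝ 1 h)
    (hs : HasCompactSupport h) {A I : Set ℝ} (hA : MeasurableSet A) (hI : tsupport h ⊆ I) {t₀ : ℝ}
    (h1 : ∀ t ∈ I, t < t₀ → t ∈ A) (h2 : ∀ t ∈ I, t₀ < t → t ∉ A) :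
    ∫ t in A, deriv h t = h t₀ := by
  rw [← hs.integral_Iic_deriv_eq hc t₀, ← integral_indicator hA,
    ← integral_indicator measurableSet_Iic]
  have hne : ∀ᵐ t : ℝ, t ≠ t₀ := by
    simp [ae_iff]
  refine integral_congr_ae ?_
  filter_upwards [hne] with t ht
  by_cases htI : t ∈ I
  · rcases lt_or_gt_of_ne ht with hlt | hlt
    · rw [Set.indicator_of_mem (h1 t htI hlt), Set.indicator_of_mem (Set.mem_Iic.2 hlt.le)]
    · rw [Set.indicator_of_notMem (h2 t htI hlt),
        Set.indicator_of_notMem (by simpa using hlt)]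
  · have : deriv h t = 0 := by
      by_contra h0
      exact htI (hI (support_deriv_subset h0))
    by_cases hA : t ∈ A <;> by_cases hB : t ∈ Set.Iic t₀ <;> simp [hA, hB, this]

theorem setIntegral_deriv_eq_zero_of_subset [CompleteSpace F] {h : ℝ → F} (hc : ContDiff ℝ 1 h)
    (hs : HasCompactSupport h) {A I : Set ℝ} (hI : tsupport h ⊆ I)
    (h1 : I ⊆ A) : ∫ t in A, deriv h t = 0 := by
  have h0 : ∫ t, deriv h t = 0 := integral_eq_zero_of_hasDerivAt_of_integrable
    (fun x => (hc.differentiable one_ne_zero x).hasDerivAt)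
    ((hc.continuous_deriv le_rfl).integrable_of_hasCompactSupport hs.deriv)
    (hc.continuous.integrable_of_hasCompactSupport hs)
  rw [← h0]
  apply setIntegral_eq_integral_of_forall_compl_eq_zero
  intro t ht
  by_contra h0
  exact ht (h1 (hI (support_deriv_subset h0)))

theorem setIntegral_deriv_eq_zero_of_disjoint {h : ℝ → F}
    {A I : Set ℝ} (hI : tsupport h ⊆ I)
    (h1 : Disjoint I A) : ∫ t in A, deriv h t = 0 := by
  apply setIntegral_eq_zero_of_forall_eq_zero
  intro t ht
  by_contra h0
  exact Set.disjoint_left.1 h1 (hI (support_deriv_subset h0)) ht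

/-- The difference of the integrals is the integral against the positive measure `l - ν`, whose mass
is at most `c - 1` times that of `ν`, for the weight `‖m‖` as well. -/
theorem norm_integral_sub_le_of_measure_le {α : Type*} [MeasurableSpace α] {ν l : Measure α}
    [IsFiniteMeasure ν] {c : ℝ} (hc : 1 ≤ c) (h1 : ν ≤ l) (h2 : l ≤ ENNReal.ofReal c • ν)
    {m : α → F} (hm : Integrable m ν) :
    ‖∫ x, m x ∂ν - ∫ x, m x ∂l‖ ≤ (c - 1) * ∫ x, ‖m x‖ ∂l := by
  have hl : Integrable m l := (hm.smul_measure ENNReal.ofReal_ne_top).mono_measure h2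
  have hsub := Measure.sub_add_cancel_of_le h1
  have hl' : Integrable m (l - ν) := hl.mono_measure Measure.sub_le
  have e1 : ∫ x, m x ∂l = ∫ x, m x ∂(l - ν) + ∫ x, m x ∂ν := by
    rw [← integral_add_measure hl' hm, hsub]
  have e2 : ∫ x, ‖m x‖ ∂l = ∫ x, ‖m x‖ ∂(l - ν) + ∫ x, ‖m x‖ ∂ν := by
    rw [← integral_add_measure hl'.norm hm.norm, hsub]
  have e3 : ∫ x, ‖m x‖ ∂l ≤ c * ∫ x, ‖m x‖ ∂ν := by
    have := integral_mono_measure h2 (f := fun x => ‖m x‖)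
      (Filter.Eventually.of_forall fun x => norm_nonneg _)
      (hm.norm.smul_measure ENNReal.ofReal_ne_top)
    rwa [integral_smul_measure, ENNReal.toReal_ofReal (by linarith), smul_eq_mul] at this
  have e4 : ∫ x, ‖m x‖ ∂ν ≤ ∫ x, ‖m x‖ ∂l := integral_mono_measure h1
      (Filter.Eventually.of_forall fun x => norm_nonneg _) hl.norm
  calc _ = ‖∫ x, m x ∂(l - ν)‖ := by rw [e1, norm_sub_rev]; simp
    _ ≤ ∫ x, ‖m x‖ ∂(l - ν) := norm_integral_le_integral_norm _
    _ ≤ (c - 1) * ∫ x, ‖m x‖ ∂ν := by linarith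
    _ ≤ _ := by gcongr

theorem euclideanHausdorffMeasure_image_le {X Y : Type*} [MetricSpace X] [MeasurableSpace X]
    [BorelSpace X] [MetricSpace Y] [MeasurableSpace Y] [BorelSpace Y] {K : NNReal} {f : X → Y}
    {s : Set X} (h : LipschitzOnWith K f s) (d : ℕ) :
    (Measure.euclideanHausdorffMeasure d : Measure Y) (f '' s) ≤
      (K : ENNReal) ^ d * (Measure.euclideanHausdorffMeasure d : Measure X) s := by
  have h1 := h.hausdorffMeasure_image_le (d := d) (Nat.cast_nonneg d)
  rw [Measure.euclideanHausdorffMeasure_def, Measure.euclideanHausdorffMeasure_def,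
    Measure.smul_apply, Measure.smul_apply, ENNReal.smul_def, ENNReal.smul_def, smul_eq_mul,
    smul_eq_mul, mul_left_comm]
  rw [ENNReal.rpow_natCast] at h1
  gcongr

/-- The normalization of the Hausdorff measure enters here: it makes the surface measure comparable
with Lebesgue measure on hyperplanes with no extra constant. -/
theorem volume_orthogonal_unit {v : ℍ[ℝ]} (hv : ‖v‖ = 1) :
    (volume : Measure (ℝ ∙ v)ᗮ) = Measure.euclideanHausdorffMeasure 3 := by
  have : Fact (Module.finrank ℝ ℍ[ℝ] = 3 + 1) := ⟨Quaternion.finrank_eq_four⟩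
  have h : Module.finrank ℝ (ℝ ∙ v)ᗮ = 3 :=
    Submodule.finrank_orthogonal_span_singleton (by rintro rfl; simp at hv)
  rw [← InnerProductSpace.euclideanHausdorffMeasure_eq_volume, h]

/-! ### Area of flat graphs -/

/-- `S` is a graph over the hyperplane orthogonal to `v`, of slope controlled by `δ`. -/
def IsFlatAlong (v : ℍ[ℝ]) (δ : ℝ) (S : Set ℍ[ℝ]) : Prop :=
  ∀ x ∈ S, ∀ y ∈ S, |inner ℝ v (x - y)| ≤ δ * ‖x - y‖

/-- By Pythagoras `(1 - δ²) ‖x - y‖²` is at most the squared distance of the projections, and `1 ≤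
(1 + 2δ²)² (1 - δ²)` for `δ² ≤ 1/2`. -/
theorem IsFlatAlong.norm_sub_le {v : ℍ[ℝ]} {δ : ℝ} {S : Set ℍ[ℝ]} (h : IsFlatAlong v δ S)
    (hv : ‖v‖ = 1) (hδ : δ ^ 2 ≤ 1 / 2) {x y : ℍ[ℝ]} (hx : x ∈ S) (hy : y ∈ S) :
    ‖x - y‖ ≤ (1 + 2 * δ ^ 2) * ‖(ℝ ∙ v)ᗮ.orthogonalProjectionOnto x -
      (ℝ ∙ v)ᗮ.orthogonalProjectionOnto y‖ := by
  rw [← map_sub]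
  have h1 := norm_sq_eq_orthogonalProjectionOnto hv (x - y)
  have h2 : inner ℝ v (x - y) ^ 2 ≤ δ ^ 2 * ‖x - y‖ ^ 2 := by
    rw [← sq_abs, ← mul_pow]
    exact pow_le_pow_left₀ (abs_nonneg _) (h x hx y hy) 2
  have h3 : (1 + 2 * δ ^ 2) ^ 2 * (1 - δ ^ 2) ≥ 1 := by
    nlinarith [sq_nonneg δ, mul_nonneg (sq_nonneg δ) (sub_nonneg.2 hδ),
      mul_nonneg (sq_nonneg (δ ^ 2)) (sub_nonneg.2 hδ)]
  refine (sq_le_sq₀ (by positivity) (by positivity)).1 ?_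
  rw [mul_pow]
  calc ‖x - y‖ ^ 2 ≤ (1 + 2 * δ ^ 2) ^ 2 * (1 - δ ^ 2) * ‖x - y‖ ^ 2 :=
        le_mul_of_one_le_left (sq_nonneg _) h3
    _ = (1 + 2 * δ ^ 2) ^ 2 * (‖x - y‖ ^ 2 - δ ^ 2 * ‖x - y‖ ^ 2) := by ring
    _ ≤ _ := by gcongr; linarith

theorem IsFlatAlong.injOn {v : ℍ[ℝ]} {δ : ℝ} {S : Set ℍ[ℝ]} (h : IsFlatAlong v δ S)
    (hv : ‖v‖ = 1) (hδ : δ ^ 2 ≤ 1 / 2) : Set.InjOn (ℝ ∙ v)ᗮ.orthogonalProjectionOnto S := by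
  intro x hx y hy hxy
  have := h.norm_sub_le hv hδ hx hy
  rw [hxy, sub_self, norm_zero, mul_zero] at this
  exact sub_eq_zero.1 (norm_le_zero_iff.1 this)

theorem IsFlatAlong.volume_image_le {v : ℍ[ℝ]} (hv : ‖v‖ = 1) (S : Set ℍ[ℝ]) :
    volume ((ℝ ∙ v)ᗮ.orthogonalProjectionOnto '' S) ≤
      (Measure.euclideanHausdorffMeasure 3 : Measure ℍ[ℝ]) S := by
  rw [volume_orthogonal_unit hv]
  simpa using euclideanHausdorffMeasure_image_le
    ((ℝ ∙ v)ᗮ.lipschitzWith_orthogonalProjectionOnto.lipschitzOnWith (s := S)) 3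

/-- The inverse of the projection on `S` is Lipschitz with constant `1 + 2δ²`. The distortion is of
second order in the slope, which the tangential estimate depends on. -/
theorem IsFlatAlong.measure_le {v : ℍ[ℝ]} {δ : ℝ} {S : Set ℍ[ℝ]} (h : IsFlatAlong v δ S)
    (hv : ‖v‖ = 1) (hδ : δ ^ 2 ≤ 1 / 2) :
    (Measure.euclideanHausdorffMeasure 3 : Measure ℍ[ℝ]) S ≤
      ENNReal.ofReal ((1 + 2 * δ ^ 2) ^ 3) * volume ((ℝ ∙ v)ᗮ.orthogonalProjectionOnto '' S) := by
  rw [volume_orthogonal_unit hv]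
  set P := (ℝ ∙ v)ᗮ.orthogonalProjectionOnto
  have hinv := (h.injOn hv hδ).leftInvOn_invFunOn
  have hL : LipschitzOnWith (Real.toNNReal (1 + 2 * δ ^ 2)) (Function.invFunOn P S) (P '' S) := by
    apply LipschitzOnWith.of_dist_le_mul
    rintro _ ⟨x, hx, rfl⟩ _ ⟨y, hy, rfl⟩
    rw [hinv hx, hinv hy, dist_eq_norm, dist_eq_norm, Real.coe_toNNReal _ (by positivity)]
    exact h.norm_sub_le hv hδ hx hy
  have := euclideanHausdorffMeasure_image_le hL 3
  rw [hinv.image_image] at this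
  rwa [ENNReal.ofReal_pow (by positivity)]

/-! ### Integration along lines transversal to the boundary -/

/-- `Ω` lies below its boundary in the direction `v`, as far as points of `U` are concerned. -/
def IsBelowAlong (v : ℍ[ℝ]) (U Ω : Set ℍ[ℝ]) : Prop :=
  ∀ x ∈ U, ∀ s : ℝ, 0 < s → x + s • v ∈ U → x + s • v ∈ closure Ω → x ∈ Ω

theorem isometry_add_smul_unit {v : ℍ[ℝ]} (hv : ‖v‖ = 1) (y : ℍ[ℝ]) :
    Isometry (fun t : ℝ => y + t • v) := by
  apply Isometry.of_dist_eq
  intro a b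
  rw [dist_add_left, dist_eq_norm, ← sub_smul, norm_smul, hv, mul_one, dist_eq_norm]

theorem deriv_comp_line {h : ℍ[ℝ] → F} (hc : ContDiff ℝ 1 h) (v y : ℍ[ℝ]) (t : ℝ) :
    deriv (fun t : ℝ => h (y + t • v)) t = fderiv ℝ h (y + t • v) v := by
  have h1 : HasDerivAt (fun t : ℝ => y + t • v) v t := by
    simpa using ((hasDerivAt_id t).smul_const v).const_add y
  exact ((hc.differentiable one_ne_zero _).hasFDerivAt.comp_hasDerivAt t h1).deriv

theorem integral_indicator_line {Ω : Set ℍ[ℝ]} (hΩ : IsOpen Ω) {h : ℍ[ℝ] → F}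
    (hc : ContDiff ℝ 1 h) (v y : ℍ[ℝ]) :
    ∫ t : ℝ, Ω.indicator (fun x => fderiv ℝ h x v) (y + t • v) =
      ∫ t in (fun t : ℝ => y + t • v) ⁻¹' Ω, deriv (fun t : ℝ => h (y + t • v)) t := by
  rw [← integral_indicator (hΩ.preimage (by fun_prop)).measurableSet]
  congr 1
  ext t
  by_cases ht : y + t • v ∈ Ω
  · rw [Set.indicator_of_mem ht, Set.indicator_of_mem (by exact ht), deriv_comp_line hc]
  · rw [Set.indicator_of_notMem ht, Set.indicator_of_notMem (by exact ht)]

/-- Within `U`, the line through the boundary point `x` is in `Ω` before `x`, and never after it,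
since otherwise `x` itself would lie in the open set `Ω`. The fundamental theorem of calculus leaves
only the value at `x`. -/
theorem integral_line_eq_of_mem [CompleteSpace F] {v : ℍ[ℝ]} (hv : ‖v‖ = 1) {U Ω : Set ℍ[ℝ]}
    (hΩ : IsOpen Ω) (hB : IsBelowAlong v U Ω) {h : ℍ[ℝ] → F} (hc : ContDiff ℝ 1 h)
    (hs : HasCompactSupport h) (hU : tsupport h ⊆ U) {x : ℍ[ℝ]} (hx : x ∈ frontier Ω ∩ U) :
    ∫ t : ℝ, Ω.indicator (fun x => fderiv ℝ h x v)
      (((ℝ ∙ v)ᗮ.orthogonalProjectionOnto x : ℍ[ℝ]) + t • v) = h x := by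
  rw [integral_indicator_line hΩ hc]
  have hx0 := orthogonalProjectionOnto_add_inner_smul hv x
  generalize ((ℝ ∙ v)ᗮ.orthogonalProjectionOnto x : ℍ[ℝ]) = y at hx0 ⊢
  generalize (inner ℝ v x : ℝ) = t₀ at hx0
  have hl := isometry_add_smul_unit hv y
  rw [setIntegral_deriv_of_initial (h := fun t : ℝ => h (y + t • v))
    (I := (fun t : ℝ => y + t • v) ⁻¹' U) (t₀ := t₀) (by fun_prop)
    (hs.comp_isClosedEmbedding hl.isClosedEmbedding) (hΩ.preimage hl.continuous).measurableSet
    ((tsupport_comp_subset_preimage h hl.continuous).trans (Set.preimage_mono hU)), hx0]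
  · intro t ht htt
    have he : y + t • v + (t₀ - t) • v = x := by rw [← hx0, sub_smul]; abel
    refine hB _ ht (t₀ - t) (by linarith) ?_ ?_
    · rw [he]; exact hx.2
    · rw [he]; exact frontier_subset_closure hx.1
  · intro t ht htt hmem
    have he : x + (t - t₀) • v = y + t • v := by rw [← hx0, sub_smul]; abel
    have : x ∈ Ω := by
      refine hB x hx.2 (t - t₀) (by linarith) ?_ ?_
      · rw [he]; exact ht
      · rw [he]; exact subset_closure hmem
    rw [hΩ.frontier_eq] at hx
    exact hx.1.2 this

/-- A line that misses the boundary inside the convex set `U` meets `U` in a connected piece, which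
lies entirely in `Ω` or entirely outside. In the first case the derivative of a compactly supported
function integrates to zero, in the second the integrand vanishes. -/
theorem integral_line_eq_of_notMem [CompleteSpace F] {v : ℍ[ℝ]} (hv : ‖v‖ = 1) {U Ω : Set ℍ[ℝ]}
    (hΩ : IsOpen Ω) (hUc : Convex ℝ U) {h : ℍ[ℝ] → F} (hc : ContDiff ℝ 1 h)
    (hs : HasCompactSupport h) (hU : tsupport h ⊆ U) {y : (ℝ ∙ v)ᗮ}
    (hy : y ∉ (ℝ ∙ v)ᗮ.orthogonalProjectionOnto '' (frontier Ω ∩ U)) :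
    ∫ t : ℝ, Ω.indicator (fun x => fderiv ℝ h x v) ((y : ℍ[ℝ]) + t • v) = 0 := by
  rw [integral_indicator_line hΩ hc]
  have hl := isometry_add_smul_unit hv (y : ℍ[ℝ])
  have hsub := (tsupport_comp_subset_preimage h hl.continuous).trans (Set.preimage_mono hU)
  have hI : IsPreconnected ((fun t : ℝ => (y : ℍ[ℝ]) + t • v) ⁻¹' U) := by
    apply Convex.isPreconnected
    intro a ha b hb α β hα hβ hαβ
    have := hUc ha hb hα hβ hαβ
    have he : (y : ℍ[ℝ]) + (α • a + β • b) • v =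
        α • ((y : ℍ[ℝ]) + a • v) + β • ((y : ℍ[ℝ]) + b • v) := by
      rw [eq_sub_of_add_eq' hαβ]
      module
    rw [Set.mem_preimage, he]
    exact this
  set A := (fun t : ℝ => (y : ℍ[ℝ]) + t • v) ⁻¹' Ω with hA
  -- A parameter in neither set would be a frontier point of `A`, hence give a point of `frontier Ω
  -- ∩ U` whose projection is `y`.
  have hcover : (fun t : ℝ => (y : ℍ[ℝ]) + t • v) ⁻¹' U ⊆ A ∪ (closure A)ᶜ := by
    intro t ht
    by_contra hn
    simp only [Set.mem_union, Set.mem_compl_iff, not_or, not_not] at hn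
    refine hy ⟨_, ⟨hl.continuous.frontier_preimage_subset Ω ?_, ht⟩,
      orthogonalProjectionOnto_add_smul y t⟩
    rw [(hΩ.preimage hl.continuous).frontier_eq]
    exact ⟨hn.2, hn.1⟩
  rcases hI.subset_or_subset (hΩ.preimage hl.continuous) isClosed_closure.isOpen_compl
    (disjoint_compl_right.mono_left subset_closure) hcover with hs1 | hs1
  · exact setIntegral_deriv_eq_zero_of_subset (h := fun t : ℝ => h ((y : ℍ[ℝ]) + t • v))
      (by fun_prop) (hs.comp_isClosedEmbedding hl.isClosedEmbedding) hsub hs1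
  · exact setIntegral_deriv_eq_zero_of_disjoint hsub
      (Set.disjoint_of_subset_left hs1 (disjoint_compl_left.mono_right subset_closure))

theorem measurableSet_frontier_inter {U Ω : Set ℍ[ℝ]} (hUo : IsOpen U) :
    MeasurableSet (frontier Ω ∩ U) := isClosed_frontier.measurableSet.inter hUo.measurableSet

theorem setIntegral_surfaceMeasure_eq {U Ω : Set ℍ[ℝ]} {h : ℍ[ℝ] → F} (hUo : IsOpen U)
    (hU : tsupport h ⊆ U) : ∫ x, h x ∂(surfaceMeasure Ω) =
      ∫ x in frontier Ω ∩ U, h x ∂(Measure.euclideanHausdorffMeasure 3) := by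
  rw [surfaceMeasure, Set.inter_comm, ← Measure.restrict_restrict hUo.measurableSet]
  symm
  apply setIntegral_eq_integral_of_forall_compl_eq_zero
  intro x hx
  by_contra h0
  exact hx (hU (subset_tsupport _ h0))

/-- By Fubini the volume integral becomes an integral over the projection of the boundary piece,
with integrand the boundary value of `h`. It remains to compare Lebesgue measure on the projection
with the pushforward of the surface measure. Their ratio lies between `1` (the projection is
1-Lipschitz) and `(1 + 2δ²)³`. -/
theorem directional_estimate [CompleteSpace F] {v : ℍ[ℝ]} (hv : ‖v‖ = 1) {U Ω : Set ℍ[ℝ]}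
    (hΩ : IsOpen Ω) (hUc : Convex ℝ U) (hUo : IsOpen U) (hUb : Bornology.IsBounded U)
    (hB : IsBelowAlong v U Ω) {δ : ℝ} (hδ : δ ^ 2 ≤ 1 / 2)
    (hF : IsFlatAlong v δ (frontier Ω ∩ U))
    {h : ℍ[ℝ] → F} (hc : ContDiff ℝ 1 h) (hs : HasCompactSupport h) (hU : tsupport h ⊆ U) :
    ‖(∫ x in Ω, fderiv ℝ h x v) - ∫ x, h x ∂(surfaceMeasure Ω)‖ ≤
      ((1 + 2 * δ ^ 2) ^ 3 - 1) * ∫ x, ‖h x‖ ∂(surfaceMeasure Ω) := by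
  have hUn : tsupport (fun x => ‖h x‖) ⊆ U := by
    refine (closure_mono ?_).trans hU
    intro x hx
    simpa using hx
  rw [setIntegral_surfaceMeasure_eq hUo hU, setIntegral_surfaceMeasure_eq hUo hUn]
  set S := frontier Ω ∩ U with hS
  have hSm : MeasurableSet S := measurableSet_frontier_inter hUo
  set P := (ℝ ∙ v)ᗮ.orthogonalProjectionOnto
  have hPm : Measurable P := P.continuous.measurable
  have hPS : MeasurableSet (P '' S) :=
    hSm.image_of_continuousOn_injOn P.continuous.continuousOn (hF.injOn hv hδ)
  set m : (ℝ ∙ v)ᗮ → F := fun y =>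
    ∫ t : ℝ, Ω.indicator (fun x => fderiv ℝ h x v) ((y : ℍ[ℝ]) + t • v)
  have hint : Integrable (Ω.indicator (fun x => fderiv ℝ h x v)) := by
    apply Integrable.indicator _ hΩ.measurableSet
    exact ((hc.continuous_fderiv one_ne_zero).clm_apply continuous_const).integrable_of_hasCompactSupport
      (hs.fderiv_apply (𝕜 := ℝ) v)
  have hΦ := measurePreserving_add_smul_unit hv
  have hint' : Integrable (fun q : (ℝ ∙ v)ᗮ × ℝ =>
      Ω.indicator (fun x => fderiv ℝ h x v) ((q.1 : ℍ[ℝ]) + q.2 • v)) (volume.prod volume) :=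
    hΦ.integrable_comp_of_integrable hint
  have hm : Integrable m := hint'.integral_prod_left
  have e1 : ∫ x in Ω, fderiv ℝ h x v = ∫ y in P '' S, m y := by
    rw [← integral_indicator hΩ.measurableSet, ← hΦ.map_eq,
      integral_map hΦ.measurable.aemeasurable (by rw [hΦ.map_eq]; exact hint.1),
      Measure.volume_eq_prod, integral_prod _ hint']
    symm
    apply setIntegral_eq_integral_of_forall_compl_eq_zero
    intro y hy
    exact integral_line_eq_of_notMem hv hΩ hUc hc hs hU hy
  have hmS : ∀ x ∈ S, m (P x) = h x := fun x hx => integral_line_eq_of_mem hv hΩ hB hc hs hU hx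
  set l := Measure.map P ((Measure.euclideanHausdorffMeasure 3 : Measure ℍ[ℝ]).restrict S) with hl
  have hfin : IsFiniteMeasure ((volume : Measure (ℝ ∙ v)ᗮ).restrict (P '' S)) := by
    constructor
    rw [Measure.restrict_apply_univ]
    refine Bornology.IsBounded.measure_lt_top ?_
    exact (ℝ ∙ v)ᗮ.lipschitzWith_orthogonalProjectionOnto.isBounded_image
      (hUb.subset Set.inter_subset_right)
  have hle1 : (volume : Measure (ℝ ∙ v)ᗮ).restrict (P '' S) ≤ l := by
    refine Measure.le_iff.2 fun A hA => ?_
    rw [Measure.restrict_apply hA, hl, Measure.map_apply hPm hA,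
      Measure.restrict_apply (hPm hA), ← Set.image_preimage_inter]
    exact IsFlatAlong.volume_image_le hv _
  have hle2 : l ≤ ENNReal.ofReal ((1 + 2 * δ ^ 2) ^ 3) •
      (volume : Measure (ℝ ∙ v)ᗮ).restrict (P '' S) := by
    refine Measure.le_iff.2 fun A hA => ?_
    rw [Measure.smul_apply, smul_eq_mul, Measure.restrict_apply hA, hl, Measure.map_apply hPm hA,
      Measure.restrict_apply (hPm hA), ← Set.image_preimage_inter]
    exact IsFlatAlong.measure_le (fun x hx y hy => hF x hx.2 y hy.2) hv hδ
  have hmr : Integrable m ((volume : Measure (ℝ ∙ v)ᗮ).restrict (P '' S)) := hm.integrableOn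
  have hml : AEStronglyMeasurable m l :=
    ((hmr.smul_measure ENNReal.ofReal_ne_top).mono_measure hle2).1
  have key := norm_integral_sub_le_of_measure_le (one_le_pow₀ (by nlinarith [sq_nonneg δ]))
    hle1 hle2 hmr
  have e2 : ∫ y, m y ∂l = ∫ x in S, h x ∂(Measure.euclideanHausdorffMeasure 3) := by
    rw [hl, integral_map hPm.aemeasurable hml]
    exact setIntegral_congr_fun hSm hmS
  have e3 : ∫ y, ‖m y‖ ∂l = ∫ x in S, ‖h x‖ ∂(Measure.euclideanHausdorffMeasure 3) := by
    rw [hl, integral_map hPm.aemeasurable hml.norm]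
    exact setIntegral_congr_fun hSm fun x hx => by simp only [hmS x hx]
  rw [e1, ← e2, ← e3]
  exact key

theorem measure_frontier_inter_lt_top {v : ℍ[ℝ]} (hv : ‖v‖ = 1) {U Ω : Set ℍ[ℝ]}
    (hUb : Bornology.IsBounded U) {δ : ℝ} (hδ : δ ^ 2 ≤ 1 / 2)
    (hF : IsFlatAlong v δ (frontier Ω ∩ U)) :
    (Measure.euclideanHausdorffMeasure 3 : Measure ℍ[ℝ]) (frontier Ω ∩ U) < ⊤ := by
  refine (hF.measure_le hv hδ).trans_lt (ENNReal.mul_lt_top ENNReal.ofReal_lt_top ?_)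
  refine Bornology.IsBounded.measure_lt_top ?_
  exact (ℝ ∙ v)ᗮ.lipschitzWith_orthogonalProjectionOnto.isBounded_image
    (hUb.subset Set.inter_subset_right)

/-! ### Local geometry of a `C¹` boundary -/

/-- One defining function serves all nearby points, so the normal is locally given by a single
continuous formula. -/
theorem IsLocalDefiningFunction.eventually {Ω : Set ℍ[ℝ]} {p : ℍ[ℝ]} {ρ : ℍ[ℝ] → ℝ}
    (h : IsLocalDefiningFunction Ω p ρ) : ∀ᶠ q in 𝓝 p, IsLocalDefiningFunction Ω q ρ := by
  have hc : ContinuousAt (fderiv ℝ ρ) p :=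
    (h.1.fderiv_right (m := 0) (by norm_num)).continuousAt
  filter_upwards [h.1.eventually (by norm_num), hc.eventually_ne h.2.1,
    eventually_eventually_nhds.2 h.2.2] with q h1 h2 h3
  exact ⟨h1, h2, h3⟩

theorem IsLocalDefiningFunction.norm_gradient_pos {Ω : Set ℍ[ℝ]} {p : ℍ[ℝ]} {ρ : ℍ[ℝ] → ℝ}
    (h : IsLocalDefiningFunction Ω p ρ) : 0 < ‖gradient ρ p‖ := by
  rw [norm_pos_iff]
  intro h0
  exact h.2.1 (by simpa [gradient] using h0)

theorem norm_outwardNormal {Ω : Set ℍ[ℝ]} (hC : HasC1Boundary Ω) {p : ℍ[ℝ]}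
    (hp : p ∈ frontier Ω) : ‖outwardNormal Ω p‖ = 1 := by
  obtain ⟨ρ, hρ⟩ := hC p hp
  rw [outwardNormal_eq hρ hp, norm_smul, norm_inv, norm_norm]
  exact inv_mul_cancel₀ hρ.norm_gradient_pos.ne'

theorem continuousOn_outwardNormal {Ω : Set ℍ[ℝ]} (hC : HasC1Boundary Ω) :
    ContinuousOn (outwardNormal Ω) (frontier Ω) := by
  intro p hp
  obtain ⟨ρ, hρ⟩ := hC p hp
  have hc : ContinuousAt (fderiv ℝ ρ) p :=
    (hρ.1.fderiv_right (m := 0) (by norm_num)).continuousAt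
  have hg : ContinuousAt (gradient ρ) p :=
    ((InnerProductSpace.toDual ℝ ℍ[ℝ]).symm.continuous.continuousAt).comp hc
  have hg' : ContinuousAt (fun q => ‖gradient ρ q‖⁻¹ • gradient ρ q) p :=
    (hg.norm.inv₀ hρ.norm_gradient_pos.ne').smul hg
  refine hg'.continuousWithinAt.congr_of_eventuallyEq ?_ (outwardNormal_eq hρ hp)
  filter_upwards [mem_nhdsWithin_of_mem_nhds hρ.eventually, self_mem_nhdsWithin] with q hq hqf
  exact outwardNormal_eq hq hqf

/-- Near a boundary point a `C¹` domain is a subgraph in every direction in a wide cone about the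
outward normal, and the boundary is flat. -/
theorem exists_ball_flat {Ω : Set ℍ[ℝ]} (hC : HasC1Boundary Ω) {p : ℍ[ℝ]} (hp : p ∈ frontier Ω)
    {κ : ℝ} (hκ : 0 < κ) :
    ∃ R > 0, IsFlatAlong (outwardNormal Ω p) κ (frontier Ω ∩ Metric.ball p R) ∧
      ∀ v : ℍ[ℝ], κ * ‖v‖ < inner ℝ (outwardNormal Ω p) v →
        IsBelowAlong v (Metric.ball p R) Ω := by
  obtain ⟨ρ, hρ⟩ := hC p hp
  have hg := hρ.norm_gradient_pos
  set g := ‖gradient ρ p‖ with hgdef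
  have hinner : ∀ w, fderiv ℝ ρ p w = g * inner ℝ (outwardNormal Ω p) w := by
    intro w
    rw [outwardNormal_eq hρ hp, real_inner_smul_left, ← mul_assoc, mul_inv_cancel₀ hg.ne', one_mul]
    simp [gradient]
  -- The tolerance `κ * g` becomes `κ` after division by the length `g` of the gradient.
  have hstrict := (hρ.1.hasStrictFDerivAt (by norm_num)).isLittleO.def (mul_pos hκ hg)
  rw [nhds_prod_eq] at hstrict
  obtain ⟨U1, hU1, hU1'⟩ := Filter.eventually_prod_self_iff (r := fun x y =>
    ‖ρ x - ρ y - fderiv ℝ ρ p (x - y)‖ ≤ κ * g * ‖x - y‖) |>.1 hstrict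
  obtain ⟨R, hR, hball⟩ := Metric.eventually_nhds_iff_ball.1
    ((Filter.eventually_iff.2 hU1 : ∀ᶠ x in 𝓝 p, x ∈ U1).and hρ.eventually)
  have hest : ∀ x ∈ Metric.ball p R, ∀ y ∈ Metric.ball p R,
      |ρ x - ρ y - g * inner ℝ (outwardNormal Ω p) (x - y)| ≤ κ * g * ‖x - y‖ := by
    intro x hx y hy
    have := hU1' x (hball x hx).1 y (hball y hy).1
    rwa [hinner, Real.norm_eq_abs] at this
  have hcl : ∀ x ∈ Metric.ball p R, x ∈ closure Ω → ρ x ≤ 0 := by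
    intro x hx hxc
    obtain ⟨h1, -, h3⟩ := (hball x hx).2
    by_contra! hlt
    have := (mem_closure_iff_frequently.1 hxc).and_eventually
      (h3.and (h1.continuousAt.eventually (lt_mem_nhds hlt)))
    obtain ⟨y, hy, hy2, hy3⟩ := this.exists
    exact absurd (hy2.1 hy) (not_lt.2 hy3.le)
  refine ⟨R, hR, ?_, ?_⟩
  · rintro x ⟨hxf, hx⟩ y ⟨hyf, hy⟩
    have h1 := hest x hx y hy
    rw [(hball x hx).2.eq_zero hxf, (hball y hy).2.eq_zero hyf, sub_zero, zero_sub, abs_neg,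
      abs_mul, abs_of_pos hg] at h1
    refine le_of_mul_le_mul_left (h1.trans_eq ?_) hg
    ring
  · intro v hv x hx s hs hxs hxc
    -- It suffices that `ρ x < 0`. At `x + s v` the value is at most `0`, and along `s v` the
    -- function increases by at least `g s (⟨n, v⟩ - κ‖v‖) > 0`.
    rw [((hball x hx).2.2.2).self_of_nhds]
    have h1 := hcl _ hxs hxc
    have h2 := hest _ hxs x hx
    rw [add_sub_cancel_left, real_inner_smul_right, norm_smul, Real.norm_eq_abs, abs_of_pos hs] at h2
    have h3 := (abs_le.1 h2).1
    have h4 : g * s * (κ * ‖v‖) < g * s * inner ℝ (outwardNormal Ω p) v := by gcongr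
    nlinarith

theorem isFiniteMeasure_surfaceMeasure {Ω : Set ℍ[ℝ]}
    (hb : Bornology.IsBounded Ω) (hC : HasC1Boundary Ω) :
    IsFiniteMeasure (surfaceMeasure Ω) := by
  constructor
  rw [surfaceMeasure, Measure.restrict_apply_univ]
  have hcomp : IsCompact (frontier Ω) :=
    Metric.isCompact_of_isClosed_isBounded isClosed_frontier
      (hb.closure.subset frontier_subset_closure)
  refine hcomp.measure_lt_top_of_nhdsWithin fun p hp => ?_
  obtain ⟨R, hR, hF, -⟩ := exists_ball_flat hC hp (κ := 1 / 2) (by norm_num)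
  refine ⟨frontier Ω ∩ Metric.ball p R, ?_, measure_frontier_inter_lt_top
    (norm_outwardNormal hC hp) Metric.isBounded_ball (by norm_num) hF⟩
  exact inter_mem_nhdsWithin _ (Metric.ball_mem_nhds p hR)

theorem ae_mem_frontier_surfaceMeasure (Ω : Set ℍ[ℝ]) :
    ∀ᵐ x ∂(surfaceMeasure Ω), x ∈ frontier Ω :=
  ae_restrict_mem isClosed_frontier.measurableSet

theorem integrable_surfaceMeasure {F : Type*} [NormedAddCommGroup F] {Ω : Set ℍ[ℝ]}
    (hb : Bornology.IsBounded Ω) (hC : HasC1Boundary Ω) {h : ℍ[ℝ] → F}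
    (hh : ContinuousOn h (frontier Ω)) : Integrable h (surfaceMeasure Ω) := by
  have := isFiniteMeasure_surfaceMeasure hb hC
  have hcomp : IsCompact (frontier Ω) :=
    Metric.isCompact_of_isClosed_isBounded isClosed_frontier
      (hb.closure.subset frontier_subset_closure)
  obtain ⟨C, hCb⟩ := hcomp.exists_bound_of_continuousOn hh
  refine Integrable.of_bound (hh.aestronglyMeasurable_of_isCompact hcomp
    isClosed_frontier.measurableSet) C ?_
  filter_upwards [ae_mem_frontier_surfaceMeasure Ω] with x hx using hCb x hx

/-! ### Gauss-Green up to a small relative error -/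

theorem integrable_fderiv_apply {h : ℍ[ℝ] → F} (hc : ContDiff ℝ 1 h) (hs : HasCompactSupport h)
    (a : ℍ[ℝ]) : Integrable (fun x => fderiv ℝ h x a) :=
  ((hc.continuous_fderiv one_ne_zero).clm_apply continuous_const).integrable_of_hasCompactSupport
    (hs.fderiv_apply (𝕜 := ℝ) a)

/-- Let `v` be `n + τ w` divided by its length `s`. Then `τ ∂_w = s ∂_v - ∂_n`, and the directional
estimates in the directions `v` and `n` compare both terms with the same surface integral up to
`O(τ²)`. Since `s - 1` is also `O(τ²)`, division by `τ` leaves an error `O(τ)`. -/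
theorem tangential_estimate [CompleteSpace F] {Ω : Set ℍ[ℝ]} (hΩ : IsOpen Ω) {n w p : ℍ[ℝ]}
    (hn : ‖n‖ = 1) (hw : ‖w‖ = 1) (hnw : inner ℝ n w = (0 : ℝ)) {τ R : ℝ} (hτ : 0 < τ)
    (hτ1 : τ ≤ 1 / 4) (hF : IsFlatAlong n τ (frontier Ω ∩ Metric.ball p R))
    (hB : ∀ v : ℍ[ℝ], τ * ‖v‖ < inner ℝ n v → IsBelowAlong v (Metric.ball p R) Ω)
    {h : ℍ[ℝ] → F} (hc : ContDiff ℝ 1 h) (hs : HasCompactSupport h)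
    (hU : tsupport h ⊆ Metric.ball p R) :
    ‖∫ x in Ω, fderiv ℝ h x w‖ ≤ 100 * τ * ∫ x, ‖h x‖ ∂(surfaceMeasure Ω) := by
  have hnn : inner ℝ n n = (1 : ℝ) := by rw [real_inner_self_eq_norm_sq, hn]; norm_num
  have hsq : ‖n + τ • w‖ ^ 2 = 1 + τ ^ 2 := by
    rw [norm_add_sq_real, hn, norm_smul, hw, real_inner_smul_right, hnw, Real.norm_eq_abs, mul_one,
      sq_abs]
    ring
  set s := ‖n + τ • w‖ with hsdef
  have hs0 : 0 ≤ s := norm_nonneg _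
  have hs1 : 1 ≤ s := by nlinarith
  have hs2 : s ≤ 1 + τ ^ 2 := by nlinarith
  set v := s⁻¹ • (n + τ • w) with hv
  have hvn : ‖v‖ = 1 := by
    rw [hv, norm_smul, norm_inv, Real.norm_eq_abs, abs_of_nonneg hs0, ← hsdef]
    exact inv_mul_cancel₀ (by linarith)
  have hsv : s • v = n + τ • w := by rw [hv, smul_inv_smul₀ (by linarith)]
  have hinn : inner ℝ n v = s⁻¹ := by
    rw [hv, real_inner_smul_right, inner_add_right, real_inner_smul_right, hnw, hnn]; ring
  have hτ2 : τ ^ 2 ≤ 1 / 16 := by nlinarith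
  have hB1 : IsBelowAlong n (Metric.ball p R) Ω := hB n (by rw [hn, hnn]; linarith)
  have hB2 : IsBelowAlong v (Metric.ball p R) Ω := by
    apply hB
    rw [hvn, hinn, mul_one, lt_inv_comm₀ hτ (by linarith)]
    have : (4 : ℝ) ≤ τ⁻¹ := by rw [le_inv_comm₀ (by norm_num) hτ]; linarith
    linarith
  -- Tilting the normal by `τ` costs at most another `τ` in the slope.
  have hF2 : IsFlatAlong v (2 * τ) (frontier Ω ∩ Metric.ball p R) := by
    intro x hx y hy
    have h1 := hF x hx y hy
    have h2 : |inner ℝ w (x - y)| ≤ ‖x - y‖ := by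
      simpa [hw] using abs_real_inner_le_norm w (x - y)
    rw [hv, real_inner_smul_left, inner_add_left, real_inner_smul_left, abs_mul, abs_inv,
      abs_of_nonneg hs0]
    calc s⁻¹ * |inner ℝ n (x - y) + τ * inner ℝ w (x - y)|
        ≤ 1 * (|inner ℝ n (x - y)| + τ * |inner ℝ w (x - y)|) := by
          gcongr
          · exact inv_le_one_of_one_le₀ hs1
          · refine (abs_add_le _ _).trans_eq ?_
            rw [abs_mul, abs_of_pos hτ]
      _ ≤ 1 * (τ * ‖x - y‖ + τ * ‖x - y‖) := by gcongr
      _ = _ := by ring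
  have e1 := directional_estimate hn hΩ (convex_ball p R) Metric.isOpen_ball Metric.isBounded_ball
    hB1 (by linarith) hF hc hs hU
  have e2 := directional_estimate hvn hΩ (convex_ball p R) Metric.isOpen_ball
    Metric.isBounded_ball hB2 (by nlinarith) hF2 hc hs hU
  set J := ∫ x, ‖h x‖ ∂(surfaceMeasure Ω)
  have hJ0 : 0 ≤ J := integral_nonneg fun x => norm_nonneg _
  have hJ : ‖∫ x, h x ∂(surfaceMeasure Ω)‖ ≤ J := norm_integral_le_integral_norm _
  set H := ∫ x, h x ∂(surfaceMeasure Ω)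
  have hlin : s • (∫ x in Ω, fderiv ℝ h x v) =
      (∫ x in Ω, fderiv ℝ h x n) + τ • (∫ x in Ω, fderiv ℝ h x w) := by
    rw [← integral_smul, ← integral_smul, ← integral_add]
    · congr 1; ext x
      rw [← map_smul, hsv, map_add, map_smul]
    · exact (integrable_fderiv_apply hc hs n).integrableOn
    · exact ((integrable_fderiv_apply hc hs w).smul τ).integrableOn
  set Iv := ∫ x in Ω, fderiv ℝ h x v
  set In := ∫ x in Ω, fderiv ℝ h x n
  set Iw := ∫ x in Ω, fderiv ℝ h x w
  have hdec : τ • Iw = s • (Iv - H) + (s - 1) • H - (In - H) := by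
    rw [smul_sub, hlin]; module
  have hnorm : τ * ‖Iw‖ ≤ s * ‖Iv - H‖ + (s - 1) * ‖H‖ + ‖In - H‖ := by
    calc τ * ‖Iw‖ = ‖τ • Iw‖ := by rw [norm_smul, Real.norm_eq_abs, abs_of_pos hτ]
      _ ≤ ‖s • (Iv - H)‖ + ‖(s - 1) • H‖ + ‖In - H‖ := by
        rw [hdec]; exact (norm_sub_le _ _).trans (by gcongr; exact norm_add_le _ _)
      _ = _ := by
        rw [norm_smul, norm_smul, Real.norm_eq_abs, Real.norm_eq_abs, abs_of_nonneg hs0,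
          abs_of_nonneg (by linarith : 0 ≤ s - 1)]
  have b1 : (1 + 2 * τ ^ 2) ^ 3 - 1 ≤ 10 * τ ^ 2 := by
    have h0 := sq_nonneg τ
    generalize τ ^ 2 = t at *
    nlinarith [mul_nonneg h0 h0, mul_nonneg h0 (sub_nonneg.2 hτ2),
      mul_nonneg (mul_nonneg h0 h0) (sub_nonneg.2 hτ2)]
  -- With `t = τ² ≤ 1/16`, `(1 + 8t)³ - 1 = 24t + 192t² + 512t³ ≤ (24 + 12 + 2) t`. The total below
  -- is then `2·38 + 1 + 10 = 87`, within the stated `100`.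
  have b2 : (1 + 2 * (2 * τ) ^ 2) ^ 3 - 1 ≤ 38 * τ ^ 2 := by
    have h0 := sq_nonneg τ
    have : (2 * τ) ^ 2 = 4 * τ ^ 2 := by ring
    rw [this]
    generalize τ ^ 2 = t at *
    nlinarith [mul_nonneg h0 h0, mul_nonneg h0 (sub_nonneg.2 hτ2),
      mul_nonneg (mul_nonneg h0 h0) (sub_nonneg.2 hτ2)]
  have hs3 : s ≤ 2 := by linarith
  have : τ * ‖Iw‖ ≤ 2 * (38 * τ ^ 2 * J) + τ ^ 2 * J + 10 * τ ^ 2 * J := by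
    refine hnorm.trans ?_
    gcongr
    · exact e2.trans (by gcongr)
    · linarith
    · exact e1.trans (by gcongr)
  refine le_of_mul_le_mul_left (this.trans ?_) hτ
  nlinarith [mul_nonneg (sq_nonneg τ) hJ0]

theorem normal_estimate [CompleteSpace F] {Ω : Set ℍ[ℝ]} (hΩ : IsOpen Ω) {n p : ℍ[ℝ]}
    (hn : ‖n‖ = 1) {τ R : ℝ} (hτ : 0 < τ)
    (hτ1 : τ ≤ 1 / 4) (hF : IsFlatAlong n τ (frontier Ω ∩ Metric.ball p R))
    (hB : ∀ v : ℍ[ℝ], τ * ‖v‖ < inner ℝ n v → IsBelowAlong v (Metric.ball p R) Ω)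
    {h : ℍ[ℝ] → F} (hc : ContDiff ℝ 1 h) (hs : HasCompactSupport h)
    (hU : tsupport h ⊆ Metric.ball p R) :
    ‖(∫ x in Ω, fderiv ℝ h x n) - ∫ x, h x ∂(surfaceMeasure Ω)‖ ≤
      10 * τ * ∫ x, ‖h x‖ ∂(surfaceMeasure Ω) := by
  have hnn : inner ℝ n n = (1 : ℝ) := by rw [real_inner_self_eq_norm_sq, hn]; norm_num
  have hJ0 : 0 ≤ ∫ x, ‖h x‖ ∂(surfaceMeasure Ω) := integral_nonneg fun x => norm_nonneg _
  have e1 := directional_estimate hn hΩ (convex_ball p R) Metric.isOpen_ball Metric.isBounded_ball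
    (hB n (by rw [hn, hnn]; linarith)) (by nlinarith : τ ^ 2 ≤ 1 / 2) hF hc hs hU
  refine e1.trans ?_
  gcongr
  nlinarith [mul_pos hτ hτ, mul_pos (mul_pos hτ hτ) hτ, mul_nonneg (mul_pos hτ hτ).le
    (sub_nonneg.2 hτ1), pow_le_pow_left₀ hτ.le hτ1 3, pow_le_pow_left₀ hτ.le hτ1 5,
    mul_nonneg hτ.le (sub_nonneg.2 (pow_le_pow_left₀ hτ.le hτ1 3)),
    mul_nonneg hτ.le (sub_nonneg.2 (pow_le_pow_left₀ hτ.le hτ1 5))]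

/-- The Gauss-Green identity holds near a boundary point up to an arbitrarily small relative
error. -/
theorem exists_ball_gauss_green_approx [CompleteSpace F] {Ω : Set ℍ[ℝ]} (hΩ : IsOpen Ω)
    (hb : Bornology.IsBounded Ω) (hC : HasC1Boundary Ω) {p : ℍ[ℝ]} (hp : p ∈ frontier Ω)
    (a : ℍ[ℝ]) {η : ℝ} (hη : 0 < η) :
    ∃ R > 0, ∀ h : ℍ[ℝ] → F, ContDiff ℝ 1 h → HasCompactSupport h →
      tsupport h ⊆ Metric.ball p R →
      ‖(∫ x in Ω, fderiv ℝ h x a) - ∫ x, (inner ℝ a (outwardNormal Ω x) : ℝ) • h x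
        ∂(surfaceMeasure Ω)‖ ≤ η * ∫ x, ‖h x‖ ∂(surfaceMeasure Ω) := by
  set n := outwardNormal Ω p with hndef
  have hn : ‖n‖ = 1 := norm_outwardNormal hC hp
  -- The number `111 = 10 + 100 + 1` collects the normal error, the tangential error and the
  -- oscillation of the normal.
  set τ := min (1 / 4) (η / (111 * (‖a‖ + 1))) with hτdef
  have hτ : 0 < τ := by positivity
  have hτ1 : τ ≤ 1 / 4 := min_le_left _ _
  have hτη : 111 * τ * ‖a‖ ≤ η := by
    have : τ * (111 * (‖a‖ + 1)) ≤ η := by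
      rw [← le_div_iff₀ (by positivity)]; exact min_le_right _ _
    nlinarith [norm_nonneg a]
  obtain ⟨R₁, hR₁, hF, hB⟩ := exists_ball_flat hC hp hτ
  obtain ⟨R₂, hR₂, hN⟩ := Metric.continuousOn_iff.1 (continuousOn_outwardNormal hC) p hp τ hτ
  refine ⟨min R₁ R₂, lt_min hR₁ hR₂, fun h hc hs hU => ?_⟩
  have hU1 := hU.trans (Metric.ball_subset_ball (min_le_left R₁ R₂))
  have hU2 := hU.trans (Metric.ball_subset_ball (min_le_right R₁ R₂))
  have e1 := normal_estimate hΩ hn hτ hτ1 hF hB hc hs hU1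
  have hhi : Integrable h (surfaceMeasure Ω) :=
    integrable_surfaceMeasure hb hC hc.continuous.continuousOn
  have hnhi : Integrable (fun x => (inner ℝ a (outwardNormal Ω x) : ℝ) • h x)
      (surfaceMeasure Ω) := integrable_surfaceMeasure hb hC
    ((continuousOn_const.inner (𝕜 := ℝ) (continuousOn_outwardNormal hC)).smul
      hc.continuous.continuousOn)
  set J := ∫ x, ‖h x‖ ∂(surfaceMeasure Ω)
  have hJ0 : 0 ≤ J := integral_nonneg fun x => norm_nonneg _
  -- freezing the normal
  have e3 : ‖(inner ℝ a n : ℝ) • (∫ x, h x ∂(surfaceMeasure Ω)) -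
      ∫ x, (inner ℝ a (outwardNormal Ω x) : ℝ) • h x ∂(surfaceMeasure Ω)‖ ≤ ‖a‖ * τ * J := by
    rw [← integral_smul, ← integral_sub (f := fun x => (inner ℝ a n : ℝ) • h x)
      (hhi.smul _) hnhi, ← integral_const_mul]
    refine norm_integral_le_of_norm_le (hhi.norm.const_mul _) ?_
    filter_upwards [ae_mem_frontier_surfaceMeasure Ω] with x hx
    rw [← sub_smul, norm_smul, ← inner_sub_right]
    by_cases h0 : h x = 0
    · simp [h0]
    · have hxU := hU2 (subset_tsupport h (by exact h0))
      gcongr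
      refine (norm_inner_le_norm _ _).trans ?_
      gcongr
      rw [← dist_eq_norm, dist_comm]
      exact (hN x hx hxU).le
  set w := a - (inner ℝ a n : ℝ) • n with hw
  have hnw : inner ℝ n w = (0 : ℝ) := by
    rw [hw, inner_sub_right, real_inner_smul_right, real_inner_self_eq_norm_sq, hn,
      real_inner_comm]; ring
  have hna : |(inner ℝ a n : ℝ)| ≤ ‖a‖ := by simpa [hn] using abs_real_inner_le_norm a n
  have hwa : ‖w‖ ≤ ‖a‖ := by
    have hww : ‖a‖ ^ 2 = ‖w‖ ^ 2 + (inner ℝ a n) ^ 2 := by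
      have : a = w + (inner ℝ a n : ℝ) • n := by rw [hw]; abel
      conv_lhs => rw [this, norm_add_sq_real, real_inner_smul_right,
        (real_inner_comm _ _).trans hnw, norm_smul, hn]
      simp
    refine (sq_le_sq₀ (norm_nonneg _) (norm_nonneg _)).1 ?_
    nlinarith [sq_nonneg (inner ℝ a n : ℝ)]
  have e2 : ‖∫ x in Ω, fderiv ℝ h x w‖ ≤ ‖a‖ * (100 * τ * J) := by
    by_cases hw0 : w = 0
    · simp only [hw0, map_zero, integral_zero, norm_zero]; positivity
    · have hwn : 0 < ‖w‖ := norm_pos_iff.2 hw0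
      have := tangential_estimate hΩ (w := ‖w‖⁻¹ • w) hn
        (by rw [norm_smul, norm_inv, norm_norm, inv_mul_cancel₀ hwn.ne'])
        (by rw [real_inner_smul_right, hnw, mul_zero]) hτ hτ1 hF hB hc hs hU1
      have heq : (∫ x in Ω, fderiv ℝ h x w) = ‖w‖ • ∫ x in Ω, fderiv ℝ h x (‖w‖⁻¹ • w) := by
        rw [← integral_smul]
        congr 1; ext x
        rw [← map_smul, smul_inv_smul₀ hwn.ne']
      rw [heq, norm_smul, norm_norm]
      gcongr
  have hlin : (∫ x in Ω, fderiv ℝ h x a) =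
      (inner ℝ a n : ℝ) • (∫ x in Ω, fderiv ℝ h x n) + ∫ x in Ω, fderiv ℝ h x w := by
    rw [← integral_smul, ← integral_add]
    · congr 1; ext x
      rw [← map_smul, ← map_add, hw]
      congr 1; abel
    · exact ((integrable_fderiv_apply hc hs n).smul _).integrableOn
    · exact (integrable_fderiv_apply hc hs w).integrableOn
  have hsplit : (∫ x in Ω, fderiv ℝ h x a) - ∫ x, (inner ℝ a (outwardNormal Ω x) : ℝ) • h x
        ∂(surfaceMeasure Ω) =
      (inner ℝ a n : ℝ) • ((∫ x in Ω, fderiv ℝ h x n) - ∫ x, h x ∂(surfaceMeasure Ω)) +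
      (∫ x in Ω, fderiv ℝ h x w) + ((inner ℝ a n : ℝ) • (∫ x, h x ∂(surfaceMeasure Ω)) -
      ∫ x, (inner ℝ a (outwardNormal Ω x) : ℝ) • h x ∂(surfaceMeasure Ω)) := by
    rw [hlin, smul_sub]; abel
  rw [hsplit]
  calc _ ≤ ‖a‖ * (10 * τ * J) + ‖a‖ * (100 * τ * J) + ‖a‖ * τ * J := by
        refine (norm_add₃_le).trans ?_
        gcongr
        rw [norm_smul, Real.norm_eq_abs]
        gcongr
    _ = 111 * τ * ‖a‖ * J := by ring
    _ ≤ η * J := by gcongr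

/-! ### From local estimates to the exact Gauss-Green formula -/

theorem exists_smooth_partition {K : Set ℍ[ℝ]} (hK : IsCompact K) {r : ℍ[ℝ] → ℝ}
    (hr : ∀ p ∈ K, 0 < r p) :
    ∃ (ι : Type) (_ : Fintype ι) (c : ι → ℍ[ℝ]) (χ : ι → ℍ[ℝ] → ℝ), (∀ i, c i ∈ K) ∧
      (∀ i, ContDiff ℝ 1 (χ i)) ∧ (∀ i, HasCompactSupport (χ i)) ∧
      (∀ i, tsupport (χ i) ⊆ Metric.ball (c i) (r (c i))) ∧ (∀ i x, 0 ≤ χ i x) ∧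
      ∀ x ∈ K, ∑ i, χ i x = 1 := by
  obtain ⟨t, ht, hcov⟩ := hK.elim_nhds_subcover (fun p => Metric.ball p (r p))
    (fun p hp => Metric.ball_mem_nhds p (hr p hp))
  obtain ⟨f, hf⟩ := SmoothPartitionOfUnity.exists_isSubordinate (modelWithCornersSelf ℝ ℍ[ℝ])
    hK.isClosed (fun p : t => Metric.ball (p : ℍ[ℝ]) (r p)) (fun _ => Metric.isOpen_ball)
    (by simpa [Set.iUnion_subtype] using hcov)
  refine ⟨t, inferInstance, fun p => p, fun p => f p, fun p => ht p p.2, fun p => ?_, fun p => ?_,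
    fun p => hf p, fun p x => f.nonneg p x, fun x hx => ?_⟩
  · exact (contMDiff_iff_contDiff.1 (f p).contMDiff).of_le (by exact_mod_cast le_top)
  · exact HasCompactSupport.of_support_subset_isCompact (isCompact_closedBall (p : ℍ[ℝ]) (r p))
      ((subset_tsupport _).trans ((hf p).trans Metric.ball_subset_closedBall))
  · rw [← finsum_eq_sum_of_fintype]
    exact f.sum_eq_one hx

theorem contDiff_smul_of_tsupport_subset {χ : ℍ[ℝ] → ℝ} {h : ℍ[ℝ] → F} {W : Set ℍ[ℝ]}
    (hχ : ContDiff ℝ 1 χ) (hW : IsOpen W) (hh : ContDiffOn ℝ 1 h W) (hs : tsupport χ ⊆ W) :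
    ContDiff ℝ 1 (fun x => χ x • h x) := by
  refine contDiff_iff_contDiffAt.2 fun x => ?_
  by_cases hx : x ∈ tsupport χ
  · exact hχ.contDiffAt.smul (hh.contDiffAt (hW.mem_nhds (hs hx)))
  · refine (contDiffAt_const (c := (0 : F))).congr_of_eventuallyEq ?_
    filter_upwards [notMem_tsupport_iff_eventuallyEq.1 hx] with y hy
    simp [hy]

theorem surfaceIntegral_eq_zero_of_tsupport_subset {Ω : Set ℍ[ℝ]} (hΩ : IsOpen Ω)
    {h : ℍ[ℝ] → F} (hs : tsupport h ⊆ Ω) (φ : ℍ[ℝ] → ℝ) :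
    ∫ x, φ x • h x ∂(surfaceMeasure Ω) = 0 := by
  refine integral_eq_zero_of_ae ?_
  filter_upwards [ae_mem_frontier_surfaceMeasure Ω] with x hx
  rw [hΩ.frontier_eq] at hx
  have : h x = 0 := by
    by_contra h0
    exact hx.2 (hs (subset_tsupport h h0))
  simp [this]

/-- Inside `Ω` the relevant piece of the boundary is empty, hence flat with slope `0`, and the error
factor `(1 + 2·0²)³ - 1` of the directional estimate vanishes. -/
theorem integral_fderiv_eq_zero_of_tsupport_subset [CompleteSpace F] {Ω : Set ℍ[ℝ]}
    (hΩ : IsOpen Ω) {p : ℍ[ℝ]} {R : ℝ} (hR : Metric.ball p R ⊆ Ω)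
    {h : ℍ[ℝ] → F} (hc : ContDiff ℝ 1 h) (hs : HasCompactSupport h)
    (hU : tsupport h ⊆ Metric.ball p R) (a : ℍ[ℝ]) : ∫ x in Ω, fderiv ℝ h x a = 0 := by
  by_cases ha : a = 0
  · simp [ha]
  have hn : 0 < ‖a‖ := norm_pos_iff.2 ha
  have hf : IsFlatAlong (‖a‖⁻¹ • a) 0 (frontier Ω ∩ Metric.ball p R) := by
    intro x hx
    rw [hΩ.frontier_eq] at hx
    exact absurd (hR hx.2) hx.1.2
  have key := directional_estimate (v := ‖a‖⁻¹ • a)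
    (by rw [norm_smul, norm_inv, norm_norm, inv_mul_cancel₀ hn.ne'])
    hΩ (convex_ball p R) Metric.isOpen_ball Metric.isBounded_ball
    (fun x hx _ _ _ _ => hR hx) (by norm_num) hf hc hs hU
  have h0 : ∫ x, h x ∂(surfaceMeasure Ω) = 0 := by
    simpa using surfaceIntegral_eq_zero_of_tsupport_subset hΩ (hU.trans hR) (fun _ => 1)
  rw [h0, sub_zero] at key
  norm_num at key
  have heq : (∫ x in Ω, fderiv ℝ h x a) = ‖a‖ • ∫ x in Ω, ‖a‖⁻¹ • fderiv ℝ h x a := by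
    rw [← integral_smul]
    congr 1; ext x
    rw [smul_inv_smul₀ hn.ne']
  rw [heq, key, smul_zero]

theorem fderiv_eq_of_eqOn {f g : ℍ[ℝ] → F} {Ω : Set ℍ[ℝ]} (hΩ : IsOpen Ω) (h : Set.EqOn f g Ω)
    {x : ℍ[ℝ]} (hx : x ∈ Ω) : fderiv ℝ f x = fderiv ℝ g x :=
  (Filter.eventuallyEq_of_mem (hΩ.mem_nhds hx) h).fderiv_eq

/-- Gauss-Green for `C¹` functions. -/
theorem gauss_green_of_contDiff [CompleteSpace F] {Ω : Set ℍ[ℝ]} (hΩ : IsOpen Ω)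
    (hb : Bornology.IsBounded Ω) (hC : HasC1Boundary Ω) {h : ℍ[ℝ] → F} (hc : ContDiff ℝ 1 h)
    (a : ℍ[ℝ]) :
    ∫ x in Ω, fderiv ℝ h x a =
      ∫ x, (inner ℝ a (outwardNormal Ω x) : ℝ) • h x ∂(surfaceMeasure Ω) := by
  have hK : IsCompact (closure Ω) := hb.isCompact_closure
  have hncont : ContinuousOn (fun x => (inner ℝ a (outwardNormal Ω x) : ℝ)) (frontier Ω) :=
    continuousOn_const.inner (𝕜 := ℝ) (continuousOn_outwardNormal hC)
  set J := ∫ x, ‖h x‖ ∂(surfaceMeasure Ω)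
  have hJ0 : 0 ≤ J := integral_nonneg fun x => norm_nonneg _
  have main : ∀ η > 0, ‖(∫ x in Ω, fderiv ℝ h x a) -
      ∫ x, (inner ℝ a (outwardNormal Ω x) : ℝ) • h x ∂(surfaceMeasure Ω)‖ ≤ η * J := by
    intro η hη
    have hloc : ∀ p ∈ closure Ω, ∃ R > 0, ∀ h : ℍ[ℝ] → F, ContDiff ℝ 1 h → HasCompactSupport h →
      tsupport h ⊆ Metric.ball p R →
      ‖(∫ x in Ω, fderiv ℝ h x a) - ∫ x, (inner ℝ a (outwardNormal Ω x) : ℝ) • h x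
        ∂(surfaceMeasure Ω)‖ ≤ η * ∫ x, ‖h x‖ ∂(surfaceMeasure Ω) := by
      intro p hp
      by_cases hpΩ : p ∈ Ω
      · obtain ⟨R, hR, hRΩ⟩ := Metric.isOpen_iff.1 hΩ p hpΩ
        refine ⟨R, hR, fun h hc hs hU => ?_⟩
        rw [integral_fderiv_eq_zero_of_tsupport_subset hΩ hRΩ hc hs hU,
          surfaceIntegral_eq_zero_of_tsupport_subset hΩ (hU.trans hRΩ), sub_zero, norm_zero]
        exact mul_nonneg hη.le (integral_nonneg fun x => norm_nonneg _)
      · exact exists_ball_gauss_green_approx hΩ hb hC (by rw [hΩ.frontier_eq]; exact ⟨hp, hpΩ⟩) a hη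
    choose! R hR hRest using hloc
    obtain ⟨ι, _, c, χ, hcK, hχ, hχs, hχU, hχ0, hχ1⟩ := exists_smooth_partition hK hR
    have hcd : ∀ i, ContDiff ℝ 1 (fun x => χ i x • h x) := fun i => (hχ i).smul hc
    have hcs : ∀ i, HasCompactSupport (fun x => χ i x • h x) := fun i => (hχs i).smul_right
    have hsum : ∀ x ∈ closure Ω, h x = ∑ i, χ i x • h x := by
      intro x hx
      rw [← Finset.sum_smul, hχ1 x hx, one_smul]
    have e1 : (∫ x in Ω, fderiv ℝ h x a) = ∑ i, ∫ x in Ω, fderiv ℝ (fun x => χ i x • h x) x a := by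
      rw [← integral_finsetSum _ fun i _ => (integrable_fderiv_apply (hcd i) (hcs i) a).integrableOn]
      refine setIntegral_congr_fun hΩ.measurableSet fun x hx => ?_
      rw [fderiv_eq_of_eqOn hΩ (fun y hy => hsum y (subset_closure hy)) hx,
        fderiv_fun_sum fun i _ => (hcd i).differentiable one_ne_zero x]
      simp
    have hint : ∀ i, Integrable (fun x => (inner ℝ a (outwardNormal Ω x) : ℝ) • χ i x • h x)
        (surfaceMeasure Ω) := fun i =>
      integrable_surfaceMeasure hb hC (hncont.smul (hcd i).continuous.continuousOn)
    have e2 : (∫ x, (inner ℝ a (outwardNormal Ω x) : ℝ) • h x ∂(surfaceMeasure Ω)) =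
        ∑ i, ∫ x, (inner ℝ a (outwardNormal Ω x) : ℝ) • χ i x • h x ∂(surfaceMeasure Ω) := by
      rw [← integral_finsetSum _ fun i _ => hint i]
      refine integral_congr_ae ?_
      filter_upwards [ae_mem_frontier_surfaceMeasure Ω] with x hx
      rw [← Finset.smul_sum, ← hsum x (frontier_subset_closure hx)]
    -- The cutoffs are nonnegative with sum `1` on the boundary, so the local error bounds add up to
    -- exactly `η * J`, however many pieces the partition has.
    have e3 : J = ∑ i, ∫ x, ‖χ i x • h x‖ ∂(surfaceMeasure Ω) := by
      rw [← integral_finsetSum _ fun i _ => (integrable_surfaceMeasure hb hC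
        (hcd i).continuous.continuousOn).norm]
      refine integral_congr_ae ?_
      filter_upwards [ae_mem_frontier_surfaceMeasure Ω] with x hx
      simp only [norm_smul, Real.norm_eq_abs, abs_of_nonneg (hχ0 _ x)]
      rw [← Finset.sum_mul, hχ1 x (frontier_subset_closure hx), one_mul]
    rw [e1, e2, e3, ← Finset.sum_sub_distrib, Finset.mul_sum]
    refine (norm_sum_le _ _).trans (Finset.sum_le_sum fun i _ => ?_)
    exact hRest (c i) (hcK i) _ (hcd i) (hcs i)
      ((tsupport_smul_subset_left (χ i) h).trans (hχU i))
  rw [← sub_eq_zero, ← norm_le_zero_iff]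
  refine le_of_forall_pos_le_add fun ε hε => ?_
  refine (main (ε / (J + 1)) (by positivity)).trans ?_
  rw [zero_add, div_mul_eq_mul_div, div_le_iff₀ (by positivity)]
  nlinarith

/-- Gauss-Green for functions of class `C¹` near the closure. -/
theorem gauss_green_of_contDiffOn_nhds [CompleteSpace F] {Ω W : Set ℍ[ℝ]} (hΩ : IsOpen Ω)
    (hb : Bornology.IsBounded Ω) (hC : HasC1Boundary Ω) (hW : IsOpen W) (hΩW : closure Ω ⊆ W)
    {h : ℍ[ℝ] → F} (hc : ContDiffOn ℝ 1 h W) (a : ℍ[ℝ]) :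
    IntegrableOn (fun x => fderiv ℝ h x a) Ω ∧ ∫ x in Ω, fderiv ℝ h x a =
      ∫ x, (inner ℝ a (outwardNormal Ω x) : ℝ) • h x ∂(surfaceMeasure Ω) := by
  have hK : IsCompact (closure Ω) := hb.isCompact_closure
  have hloc : ∀ p ∈ closure Ω, ∃ R > 0, Metric.ball p R ⊆ W := fun p hp =>
    Metric.isOpen_iff.1 hW p (hΩW hp)
  choose! R hR hRW using hloc
  obtain ⟨ι, _, c, χ, hcK, hχ, hχs, hχU, hχ0, hχ1⟩ := exists_smooth_partition hK hR
  -- A globally `C¹`, compactly supported function that agrees with `h` on the closure.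
  set h' : ℍ[ℝ] → F := fun x => ∑ i, χ i x • h x with hh'
  have hcd : ∀ i, ContDiff ℝ 1 (fun x => χ i x • h x) := fun i =>
    contDiff_smul_of_tsupport_subset (hχ i) hW hc ((hχU i).trans (hRW _ (hcK i)))
  have hc' : ContDiff ℝ 1 h' := ContDiff.sum fun i _ => hcd i
  have hs' : HasCompactSupport h' := by
    refine HasCompactSupport.of_support_subset_isCompact (isCompact_iUnion hχs) fun x hx => ?_
    obtain ⟨i, -, hi⟩ := Finset.exists_ne_zero_of_sum_ne_zero hx
    refine Set.mem_iUnion.2 ⟨i, subset_tsupport _ ?_⟩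
    intro h0
    exact hi (by simp [h0])
  have heq : Set.EqOn h h' (closure Ω) := by
    intro x hx
    rw [hh']
    simp only
    rw [← Finset.sum_smul, hχ1 x hx, one_smul]
  have hfd : Set.EqOn (fun x => fderiv ℝ h x a) (fun x => fderiv ℝ h' x a) Ω := by
    intro x hx
    simp only [fderiv_eq_of_eqOn hΩ (heq.mono subset_closure) hx]
  refine ⟨(integrable_fderiv_apply hc' hs' a).integrableOn.congr_fun hfd.symm hΩ.measurableSet, ?_⟩
  rw [setIntegral_congr_fun hΩ.measurableSet hfd, gauss_green_of_contDiff hΩ hb hC hc']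
  refine integral_congr_ae ?_
  filter_upwards [ae_mem_frontier_surfaceMeasure Ω] with x hx
  rw [heq (frontier_subset_closure hx)]

/-! ### The divergence theorem for fields continuous up to the boundary -/

/-- Near a boundary point, a step back along the outward normal at that point enters `Ω` from
anywhere in the closure, because `Ω` lies below its boundary in that direction. Near an interior
point no shift is needed, and `n = 0`. -/
theorem exists_inward_shift {Ω : Set ℍ[ℝ]} (hΩ : IsOpen Ω) (hC : HasC1Boundary Ω) {p : ℍ[ℝ]}
    (hp : p ∈ closure Ω) : ∃ (n : ℍ[ℝ]) (R : ℝ), 0 < R ∧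
      ∀ x ∈ closure Ω ∩ Metric.ball p R, ∀ s : ℝ, 0 < s → s < R → x - s • n ∈ Ω := by
  by_cases hpΩ : p ∈ Ω
  · obtain ⟨R, hR, hRΩ⟩ := Metric.isOpen_iff.1 hΩ p hpΩ
    exact ⟨0, R, hR, fun x hx s _ _ => by simpa using hRΩ hx.2⟩
  · have hpf : p ∈ frontier Ω := by rw [hΩ.frontier_eq]; exact ⟨hp, hpΩ⟩
    have hn := norm_outwardNormal hC hpf
    obtain ⟨R, hR, -, hB⟩ := exists_ball_flat hC hpf (κ := 1 / 2) (by norm_num)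
    -- Halving the radius keeps both the point and its shift in the ball where the subgraph property
    -- holds.
    refine ⟨outwardNormal Ω p, R / 2, by positivity, fun x hx s hs hsR => ?_⟩
    have hx2 := Metric.mem_ball.1 hx.2
    have hB' := hB (outwardNormal Ω p) (by rw [real_inner_self_eq_norm_sq, hn]; norm_num)
    refine hB' _ ?_ s hs ?_ ?_
    · rw [Metric.mem_ball, dist_eq_norm]
      rw [dist_eq_norm] at hx2
      calc ‖x - s • outwardNormal Ω p - p‖ = ‖(x - p) - s • outwardNormal Ω p‖ := by
            congr 1; abel
        _ ≤ ‖x - p‖ + ‖s • outwardNormal Ω p‖ := norm_sub_le _ _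
        _ < R / 2 + R / 2 := by
            rw [norm_smul, hn, Real.norm_eq_abs, abs_of_pos hs, mul_one]
            exact add_lt_add hx2 hsR
        _ = R := by ring
    · rw [sub_add_cancel, Metric.mem_ball]; linarith
    · rw [sub_add_cancel]; exact hx.1

/-- The divergence theorem, localized by a cutoff supported where the domain can be pushed
inwards. -/
theorem divergence_theorem_cutoff [CompleteSpace F] {ι : Type*} [Fintype ι] {Ω : Set ℍ[ℝ]}
    (hΩ : IsOpen Ω) (hb : Bornology.IsBounded Ω) (hC : HasC1Boundary Ω) {H : ι → ℍ[ℝ] → F}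
    (e : ι → ℍ[ℝ]) {q : ℍ[ℝ] → F} (hHc : ∀ k, ContinuousOn (H k) (closure Ω))
    (hHd : ∀ k, ContDiffOn ℝ 1 (H k) Ω) (hq : ContinuousOn q (closure Ω))
    (hdiv : ∀ x ∈ Ω, ∑ k, fderiv ℝ (H k) x (e k) = q x) {χ : ℍ[ℝ] → ℝ} (hχ : ContDiff ℝ 1 χ)
    {n : ℍ[ℝ]} {R : ℝ} (hR : 0 < R)
    (hshift : ∀ x ∈ closure Ω ∩ tsupport χ, ∀ s : ℝ, 0 < s → s < R → x - s • n ∈ Ω) :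
    ∫ x, χ x • ∑ k, (inner ℝ (e k) (outwardNormal Ω x) : ℝ) • H k x ∂(surfaceMeasure Ω) =
      ∫ x in Ω, χ x • q x + ∑ k, (fderiv ℝ χ x (e k)) • H k x := by
  have hK : IsCompact (closure Ω) := hb.isCompact_closure
  -- the shifted functions, extended by zero
  set G : ι → ℍ[ℝ] → F := fun k => (closure Ω).indicator (H k) with hG
  set Q : ℍ[ℝ] → F := (closure Ω).indicator q with hQ
  have hmeas : ∀ {f : ℍ[ℝ] → F}, ContinuousOn f (closure Ω) →
      AEStronglyMeasurable ((closure Ω).indicator f) volume := fun hf =>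
    (aestronglyMeasurable_indicator_iff isClosed_closure.measurableSet).2
      (hf.aestronglyMeasurable_of_isCompact hK isClosed_closure.measurableSet)
  have hbound : ∀ {f : ℍ[ℝ] → F}, ContinuousOn f (closure Ω) →
      ∃ C, 0 ≤ C ∧ ∀ x, ‖(closure Ω).indicator f x‖ ≤ C := by
    intro f hf
    obtain ⟨C, hCb⟩ := hK.exists_bound_of_continuousOn hf
    refine ⟨max C 0, le_max_right _ _, fun x => ?_⟩
    by_cases hx : x ∈ closure Ω
    · rw [Set.indicator_of_mem hx]; exact (hCb x hx).trans (le_max_left _ _)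
    · rw [Set.indicator_of_notMem hx, norm_zero]; exact le_max_right _ _
  have hlim : ∀ {f : ℍ[ℝ] → F}, ContinuousOn f (closure Ω) → ∀ x ∈ closure Ω ∩ tsupport χ,
      Filter.Tendsto (fun s : ℝ => (closure Ω).indicator f (x - s • n)) (𝓝[>] 0) (𝓝 (f x)) := by
    intro f hf x hx
    have h1 : Filter.Tendsto (fun s : ℝ => x - s • n) (𝓝[>] 0) (𝓝[closure Ω] x) := by
      refine tendsto_nhdsWithin_iff.2 ⟨?_, ?_⟩
      · have : Continuous (fun s : ℝ => x - s • n) := by fun_prop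
        have := (this.tendsto 0).mono_left (nhdsWithin_le_nhds (s := Set.Ioi (0 : ℝ)))
        simpa using this
      · filter_upwards [Ioo_mem_nhdsGT hR] with s hs
        exact subset_closure (hshift x hx s hs.1 hs.2)
    refine ((hf x hx.1).tendsto.comp h1).congr' ?_
    filter_upwards [Ioo_mem_nhdsGT hR] with s hs
    rw [Set.indicator_of_mem (subset_closure (hshift x hx s hs.1 hs.2))]
    rfl
  have hχ0 : ∀ x, x ∉ tsupport χ → χ x = 0 := fun x hx => image_eq_zero_of_notMem_tsupport hx
  have hdχ0 : ∀ x, x ∉ tsupport χ → fderiv ℝ χ x = 0 := fun x hx => by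
    by_contra h0
    exact hx (support_fderiv_subset ℝ h0)
  have hcχ : Continuous (fderiv ℝ χ) := hχ.continuous_fderiv one_ne_zero
  -- regularity of the shifted functions near the closure
  have hreg : ∀ s : ℝ, 0 < s → s < R → ∃ W, IsOpen W ∧ closure Ω ⊆ W ∧
      ∀ k, ContDiffOn ℝ 1 (fun x => χ x • G k (x - s • n)) W := by
    intro s hs hsR
    have hpre : IsOpen ((fun x : ℍ[ℝ] => x - s • n) ⁻¹' Ω) := hΩ.preimage (by fun_prop)
    -- On the first set the shifted field is `C¹`; on the second the product vanishes identically.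
    -- Together they cover the closure by the shift hypothesis.
    refine ⟨(fun x => x - s • n) ⁻¹' Ω ∪ (tsupport χ)ᶜ,
      hpre.union (isClosed_tsupport χ).isOpen_compl, ?_, fun k => ?_⟩
    · intro x hx
      by_cases hxχ : x ∈ tsupport χ
      · exact Or.inl (hshift x ⟨hx, hxχ⟩ s hs hsR)
      · exact Or.inr hxχ
    · rintro x (hx | hx)
      · have hGd : ContDiffAt ℝ 1 (G k) (x - s • n) := by
          refine ((hHd k).contDiffAt (hΩ.mem_nhds hx)).congr_of_eventuallyEq ?_
          filter_upwards [hΩ.mem_nhds hx] with y hy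
          rw [hG]
          exact Set.indicator_of_mem (subset_closure hy) _
        have : ContDiffAt ℝ 1 (fun x => G k (x - s • n)) x :=
          
          ContDiffAt.comp (g := G k) (f := fun x => x - s • n) x hGd
            (contDiffAt_id.sub contDiffAt_const)
        exact (hχ.contDiffAt.smul this).contDiffWithinAt
      · refine ((contDiffAt_const (c := (0 : F))).congr_of_eventuallyEq ?_).contDiffWithinAt
        filter_upwards [notMem_tsupport_iff_eventuallyEq.1 hx] with y hy
        simp [hy]
  -- the identity for the shifted functions
  have hid : ∀ s : ℝ, 0 < s → s < R →
      ∫ x, χ x • ∑ k, (inner ℝ (e k) (outwardNormal Ω x) : ℝ) • G k (x - s • n)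
        ∂(surfaceMeasure Ω) =
      ∫ x in Ω, χ x • Q (x - s • n) + ∑ k, (fderiv ℝ χ x (e k)) • G k (x - s • n) := by
    intro s hs hsR
    obtain ⟨W, hW, hΩW, hWc⟩ := hreg s hs hsR
    have hgg := fun k => gauss_green_of_contDiffOn_nhds hΩ hb hC hW hΩW (hWc k) (e k)
    have hsi : ∀ k, Integrable (fun x => (inner ℝ (e k) (outwardNormal Ω x) : ℝ) •
        χ x • G k (x - s • n)) (surfaceMeasure Ω) := fun k =>
      integrable_surfaceMeasure hb hC
        ((continuousOn_const.inner (𝕜 := ℝ) (continuousOn_outwardNormal hC)).smul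
        ((hWc k).continuousOn.mono (frontier_subset_closure.trans hΩW)))
    calc _ = ∑ k, ∫ x, (inner ℝ (e k) (outwardNormal Ω x) : ℝ) • χ x • G k (x - s • n)
          ∂(surfaceMeasure Ω) := by
          rw [← integral_finsetSum _ fun k _ => hsi k]
          congr 1; ext x
          rw [Finset.smul_sum]
          refine Finset.sum_congr rfl fun k _ => ?_
          rw [smul_comm]
      _ = ∑ k, ∫ x in Ω, fderiv ℝ (fun x => χ x • G k (x - s • n)) x (e k) :=
          Finset.sum_congr rfl fun k _ => (hgg k).2.symm
      _ = ∫ x in Ω, ∑ k, fderiv ℝ (fun x => χ x • G k (x - s • n)) x (e k) :=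
          (integral_finsetSum _ fun k _ => (hgg k).1).symm
      _ = _ := by
          refine setIntegral_congr_fun hΩ.measurableSet fun x hx => ?_
          by_cases hxχ : x ∈ tsupport χ
          · have hxs := hshift x ⟨subset_closure hx, hxχ⟩ s hs hsR
            have hder : ∀ k, HasFDerivAt (fun x => G k (x - s • n))
                (fderiv ℝ (H k) (x - s • n)) x := by
              intro k
              have h1 : HasFDerivAt (G k) (fderiv ℝ (H k) (x - s • n)) (x - s • n) := by
                refine (((hHd k).contDiffAt (hΩ.mem_nhds hxs)).differentiableAt
                  one_ne_zero).hasFDerivAt.congr_of_eventuallyEq ?_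
                filter_upwards [hΩ.mem_nhds hxs] with y hy
                exact Set.indicator_of_mem (subset_closure hy) _
              exact h1.comp x ((hasFDerivAt_id x).sub_const (s • n))
            have hder2 : ∀ k, fderiv ℝ (fun x => χ x • G k (x - s • n)) x (e k) =
                χ x • fderiv ℝ (H k) (x - s • n) (e k) + fderiv ℝ χ x (e k) • G k (x - s • n) := by
              intro k
              rw [((hχ.differentiable one_ne_zero x).hasFDerivAt.fun_smul (hder k)).fderiv]
              simp
            simp only [hder2]
            -- Only the total divergence appears, so the individual partial derivatives need no
            -- limit at the boundary; `q` is what must extend continuously.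
            rw [Finset.sum_add_distrib, ← Finset.smul_sum, hdiv _ hxs, hQ,
              Set.indicator_of_mem (subset_closure hxs)]
          · have h0 : ∀ k, fderiv ℝ (fun x => χ x • G k (x - s • n)) x = 0 := by
              intro k
              have : (fun x => χ x • G k (x - s • n)) =ᶠ[𝓝 x] fun _ => 0 := by
                filter_upwards [notMem_tsupport_iff_eventuallyEq.1 hxχ] with y hy
                simp [hy]
              rw [this.fderiv_eq]
              simp
            simp [h0, hχ0 x hxχ, hdχ0 x hxχ]
  -- passage to the limit
  have hl1 : Filter.Tendsto (fun s : ℝ => ∫ x, χ x • ∑ k,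
      (inner ℝ (e k) (outwardNormal Ω x) : ℝ) • G k (x - s • n) ∂(surfaceMeasure Ω)) (𝓝[>] 0)
      (𝓝 (∫ x, χ x • ∑ k, (inner ℝ (e k) (outwardNormal Ω x) : ℝ) • H k x
        ∂(surfaceMeasure Ω))) := by
    choose C hC0 hCb using fun k => hbound (hHc k)
    refine tendsto_integral_filter_of_dominated_convergence
      (fun x => |χ x| * ∑ k, ‖e k‖ * C k) ?_ ?_ ?_ ?_
    · filter_upwards [Ioo_mem_nhdsGT hR] with s hs
      obtain ⟨W, hW, hΩW, hWc⟩ := hreg s hs.1 hs.2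
      refine (integrable_surfaceMeasure hb hC ?_).1
      have : ContinuousOn (fun x => ∑ k, (inner ℝ (e k) (outwardNormal Ω x) : ℝ) •
          χ x • G k (x - s • n)) (frontier Ω) :=
        continuousOn_finsetSum _ fun k _ =>
          (continuousOn_const.inner (𝕜 := ℝ) (continuousOn_outwardNormal hC)).smul
          ((hWc k).continuousOn.mono (frontier_subset_closure.trans hΩW))
      refine this.congr fun x _ => ?_
      rw [Finset.smul_sum]
      exact Finset.sum_congr rfl fun k _ => smul_comm _ _ _
    · refine Filter.Eventually.of_forall fun s => ?_
      filter_upwards [ae_mem_frontier_surfaceMeasure Ω] with x hx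
      rw [norm_smul, Real.norm_eq_abs]
      gcongr
      refine norm_sum_le_of_le _ fun k _ => ?_
      rw [norm_smul]
      gcongr
      · refine (norm_inner_le_norm _ _).trans_eq ?_
        rw [norm_outwardNormal hC hx, mul_one]
      · exact hCb k _
    · exact (integrable_surfaceMeasure hb hC hχ.continuous.continuousOn).norm.mul_const _
    · filter_upwards [ae_mem_frontier_surfaceMeasure Ω] with x hx
      by_cases hxχ : x ∈ tsupport χ
      · exact (tendsto_finsetSum _ fun k _ =>
          (hlim (hHc k) x ⟨frontier_subset_closure hx, hxχ⟩).const_smul _).const_smul _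
      · simp [hχ0 x hxχ]
  have hl2 : Filter.Tendsto (fun s : ℝ => ∫ x in Ω, χ x • Q (x - s • n) +
      ∑ k, (fderiv ℝ χ x (e k)) • G k (x - s • n)) (𝓝[>] 0)
      (𝓝 (∫ x in Ω, χ x • q x + ∑ k, (fderiv ℝ χ x (e k)) • H k x)) := by
    choose C hC0 hCb using fun k => hbound (hHc k)
    obtain ⟨D, hD0, hDb⟩ := hbound hq
    have hcont : ∀ {φ : ℍ[ℝ] → ℝ}, Continuous φ → IntegrableOn (fun x => |φ x|) Ω := fun hφ =>
      (hφ.abs.continuousOn.integrableOn_compact hK).mono_set subset_closure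
    refine tendsto_integral_filter_of_dominated_convergence
      (fun x => |χ x| * D + ∑ k, |fderiv ℝ χ x (e k)| * C k) ?_ ?_ ?_ ?_
    · refine Filter.Eventually.of_forall fun s => ?_
      have hmp : MeasurePreserving (fun x : ℍ[ℝ] => x - s • n) volume volume :=
        measurePreserving_sub_right volume (s • n)
      refine AEStronglyMeasurable.restrict ?_
      refine (hχ.continuous.aestronglyMeasurable.smul
        ((hmeas hq).comp_measurePreserving hmp)).add
        (Finset.aestronglyMeasurable_fun_sum _ fun k _ => ?_)
      exact (hcχ.clm_apply continuous_const).aestronglyMeasurable.smul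
        ((hmeas (hHc k)).comp_measurePreserving hmp)
    · refine Filter.Eventually.of_forall fun s => Filter.Eventually.of_forall fun x => ?_
      refine (norm_add_le _ _).trans ?_
      rw [norm_smul, Real.norm_eq_abs]
      gcongr
      · exact hDb _
      · refine norm_sum_le_of_le _ fun k _ => ?_
        rw [norm_smul, Real.norm_eq_abs]
        gcongr
        exact hCb k _
    · exact ((hcont hχ.continuous).mul_const D).add (integrable_finsetSum _ fun k _ =>
        (hcont (hcχ.clm_apply continuous_const)).mul_const _)
    · filter_upwards [ae_restrict_mem hΩ.measurableSet] with x hx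
      by_cases hxχ : x ∈ tsupport χ
      · have hx' : x ∈ closure Ω ∩ tsupport χ := ⟨subset_closure hx, hxχ⟩
        exact ((hlim hq x hx').const_smul _).add
          (tendsto_finsetSum _ fun k _ => (hlim (hHc k) x hx').const_smul _)
      · simp [hχ0 x hxχ, hdχ0 x hxχ]
  refine tendsto_nhds_unique hl1 (hl2.congr' ?_)
  filter_upwards [Ioo_mem_nhdsGT hR] with s hs
  exact (hid s hs.1 hs.2).symm

/-- The divergence theorem on a bounded `C¹` domain, for fields that are `C¹` inside and continuous
up to the boundary, with a divergence that is continuous up to the boundary. -/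
theorem divergence_theorem [CompleteSpace F] {ι : Type*} [Fintype ι] {Ω : Set ℍ[ℝ]}
    (hΩ : IsOpen Ω) (hb : Bornology.IsBounded Ω) (hC : HasC1Boundary Ω) {H : ι → ℍ[ℝ] → F}
    (e : ι → ℍ[ℝ]) {q : ℍ[ℝ] → F} (hHc : ∀ k, ContinuousOn (H k) (closure Ω))
    (hHd : ∀ k, ContDiffOn ℝ 1 (H k) Ω) (hq : ContinuousOn q (closure Ω))
    (hdiv : ∀ x ∈ Ω, ∑ k, fderiv ℝ (H k) x (e k) = q x) :
    ∫ x, ∑ k, (inner ℝ (e k) (outwardNormal Ω x) : ℝ) • H k x ∂(surfaceMeasure Ω) =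
      ∫ x in Ω, q x := by
  have hK : IsCompact (closure Ω) := hb.isCompact_closure
  choose! n R hR hshift using fun p (hp : p ∈ closure Ω) => exists_inward_shift hΩ hC hp
  obtain ⟨κ, _, c, χ, hcK, hχ, hχs, hχU, hχ0, hχ1⟩ := exists_smooth_partition hK hR
  have hloc := fun i => divergence_theorem_cutoff hΩ hb hC e hHc hHd hq hdiv (hχ i)
    (hR _ (hcK i)) (n := n (c i)) fun x hx => hshift _ (hcK i) x ⟨hx.1, hχU i hx.2⟩
  have hX : ContinuousOn (fun x => ∑ k, (inner ℝ (e k) (outwardNormal Ω x) : ℝ) • H k x)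
      (frontier Ω) := continuousOn_finsetSum _ fun k _ =>
    (continuousOn_const.inner (𝕜 := ℝ) (continuousOn_outwardNormal hC)).smul
      ((hHc k).mono frontier_subset_closure)
  calc _ = ∫ x, ∑ i, χ i x • ∑ k, (inner ℝ (e k) (outwardNormal Ω x) : ℝ) • H k x
        ∂(surfaceMeasure Ω) := by
        refine integral_congr_ae ?_
        filter_upwards [ae_mem_frontier_surfaceMeasure Ω] with x hx
        rw [← Finset.sum_smul, hχ1 x (frontier_subset_closure hx), one_smul]
    _ = ∑ i, ∫ x, χ i x • ∑ k, (inner ℝ (e k) (outwardNormal Ω x) : ℝ) • H k x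
        ∂(surfaceMeasure Ω) := integral_finsetSum _ fun i _ =>
          integrable_surfaceMeasure hb hC ((hχ i).continuous.continuousOn.smul hX)
    _ = ∑ i, ∫ x in Ω, χ i x • q x + ∑ k, (fderiv ℝ (χ i) x (e k)) • H k x :=
        Finset.sum_congr rfl fun i _ => hloc i
    _ = ∫ x in Ω, ∑ i, (χ i x • q x + ∑ k, (fderiv ℝ (χ i) x (e k)) • H k x) := by
        refine (integral_finsetSum _ fun i _ => ?_).symm
        have : ContinuousOn (fun x => χ i x • q x + ∑ k, (fderiv ℝ (χ i) x (e k)) • H k x)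
            (closure Ω) := ((hχ i).continuous.continuousOn.smul hq).add
          (continuousOn_finsetSum _ fun k _ => ((((hχ i).continuous_fderiv one_ne_zero).clm_apply
            continuous_const).continuousOn.smul (hHc k)))
        exact (this.integrableOn_compact hK).mono_set subset_closure
    _ = _ := by
        refine setIntegral_congr_fun hΩ.measurableSet fun x hx => ?_
        -- The cutoffs sum to `1` on `Ω`, so their derivatives cancel there and the extra terms of
        -- the localized identities disappear.
        have hd : ∀ a, ∑ i, fderiv ℝ (χ i) x a = 0 := by
          intro a
          have h1 : fderiv ℝ (fun y => ∑ i, χ i y) x = fderiv ℝ (fun _ => (1 : ℝ)) x :=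
            fderiv_eq_of_eqOn hΩ (fun y hy => hχ1 y (subset_closure hy)) hx
          rw [fderiv_fun_sum fun i _ => (hχ i).differentiable one_ne_zero x] at h1
          have h2 := congrArg (fun L => L a) h1
          simpa using h2
        rw [Finset.sum_add_distrib, ← Finset.sum_smul, hχ1 x (subset_closure hx), one_smul,
          Finset.sum_comm]
        simp_rw [← Finset.sum_smul, hd, zero_smul, Finset.sum_const_zero, add_zero]

/-! ### The smoothed kernel and its divergence -/

theorem thetaInner_eq_inner (θ : ℝ) (x y : ℍ[ℝ]) : thetaInner θ x y = inner ℝ x y := by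
  conv_rhs => rw [← sum_coord_smul_psi θ y, inner_sum]
  refine Finset.sum_congr rfl fun k _ => ?_
  rw [real_inner_smul_right, coord, real_inner_comm, mul_comm]

theorem norm_psi (θ : ℝ) (k : Fin 4) : ‖psi θ k‖ = 1 := by
  have h := Real.sin_sq_add_cos_sq θ
  have : ‖psi θ k‖ ^ 2 = 1 := by
    rw [sq, ← Quaternion.normSq_eq_norm_mul_self, Quaternion.normSq_def']
    fin_cases k <;> simp [psi, qi_parts, qj_parts, qexp_parts]
  exact (sq_eq_sq₀ (norm_nonneg _) zero_le_one).1 (by simpa using this)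

theorem star_mul_self_eq (x : ℍ[ℝ]) : star x * x = ((‖x‖ ^ 2 : ℝ) : ℍ[ℝ]) := by
  rw [Quaternion.star_mul_self, Quaternion.normSq_eq_norm_mul_self, sq]

theorem self_mul_star_eq (x : ℍ[ℝ]) : x * star x = ((‖x‖ ^ 2 : ℝ) : ℍ[ℝ]) := by
  rw [Quaternion.self_mul_star, Quaternion.normSq_eq_norm_mul_self, sq]

/-- The profile `t⁻²`, replaced below `a` by its tangent line at `a`. -/
def tangentProfile (a t : ℝ) : ℝ := if t ≤ a then a⁻¹ ^ 2 * (3 - 2 * t * a⁻¹) else t⁻¹ ^ 2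

/-- The maximum freezes the slope below `a`, so that one visibly continuous formula covers both
branches. -/
def tangentProfileDeriv (a t : ℝ) : ℝ := -2 * (max t a)⁻¹ ^ 3

theorem tangentProfile_of_le {a t : ℝ} (ha : 0 < a) (h : a ≤ t) :
    tangentProfile a t = t⁻¹ ^ 2 := by
  rcases h.eq_or_lt with rfl | h
  · rw [tangentProfile, if_pos le_rfl, mul_assoc, mul_inv_cancel₀ ha.ne']
    norm_num
  · rw [tangentProfile, if_neg (not_le.2 h)]

theorem tangentProfileDeriv_of_le {a t : ℝ} (h : a ≤ t) :
    tangentProfileDeriv a t = -2 * t⁻¹ ^ 3 := by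
  rw [tangentProfileDeriv, max_eq_left h]

theorem hasDerivAt_tangentProfile {a : ℝ} (ha : 0 < a) (t : ℝ) :
    HasDerivAt (tangentProfile a) (tangentProfileDeriv a t) t := by
  have h1 : ∀ t, HasDerivAt (fun t : ℝ => a⁻¹ ^ 2 * (3 - 2 * t * a⁻¹)) (-2 * a⁻¹ ^ 3) t := by
    intro t
    have := ((((hasDerivAt_id t).const_mul 2).mul_const a⁻¹).const_sub 3).const_mul (a⁻¹ ^ 2)
    convert! this using 1
    ring
  have h2 : ∀ t : ℝ, 0 < t → HasDerivAt (fun t : ℝ => t⁻¹ ^ 2) (-2 * t⁻¹ ^ 3) t := by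
    intro t ht
    have := (hasDerivAt_inv ht.ne').pow 2
    convert! this using 1
    norm_num
    ring
  rcases lt_trichotomy t a with h | rfl | h
  · rw [tangentProfileDeriv, max_eq_right h.le]
    refine (h1 t).congr_of_eventuallyEq ?_
    filter_upwards [gt_mem_nhds h] with s hs
    exact if_pos hs.le
  · have hl : HasDerivWithinAt (tangentProfile t) (-2 * t⁻¹ ^ 3) (Set.Iic t) t :=
      (h1 t).hasDerivWithinAt.congr (fun s hs => if_pos hs) (if_pos le_rfl)
    have hr : HasDerivWithinAt (tangentProfile t) (-2 * t⁻¹ ^ 3) (Set.Ici t) t :=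
      (h2 t ha).hasDerivWithinAt.congr (fun s hs => tangentProfile_of_le ha hs)
        (tangentProfile_of_le ha le_rfl)
    rw [tangentProfileDeriv_of_le le_rfl, ← hasDerivWithinAt_univ, ← Set.Iic_union_Ici (a := t)]
    exact hl.union hr
  · rw [tangentProfileDeriv_of_le h.le]
    refine (h2 t (ha.trans h)).congr_of_eventuallyEq ?_
    filter_upwards [lt_mem_nhds h] with s hs
    exact tangentProfile_of_le ha (le_of_lt hs)

theorem continuous_tangentProfileDeriv {a : ℝ} (ha : 0 < a) :
    Continuous (tangentProfileDeriv a) := by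
  have h : Continuous fun t : ℝ => (max t a)⁻¹ :=
    (continuous_id.max continuous_const).inv₀ fun t => (ha.trans_le (le_max_right _ _)).ne'
  exact continuous_const.mul (h.pow 3)

theorem contDiff_tangentProfile {a : ℝ} (ha : 0 < a) : ContDiff ℝ 1 (tangentProfile a) := by
  rw [contDiff_one_iff_deriv]
  refine ⟨fun t => (hasDerivAt_tangentProfile ha t).differentiableAt, ?_⟩
  rw [show deriv (tangentProfile a) = tangentProfileDeriv a from
    funext fun t => (hasDerivAt_tangentProfile ha t).deriv]
  exact continuous_tangentProfileDeriv ha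

/-- Quaternion conjugation as a continuous linear map. -/
def starCLM : ℍ[ℝ] →L[ℝ] ℍ[ℝ] :=
  LinearMap.toContinuousLinearMap
    { toFun := star
      map_add' := star_add
      map_smul' := fun c x => by simp }

theorem starCLM_apply (x : ℍ[ℝ]) : starCLM x = star x := rfl

/-- The Cauchy kernel, made `C¹` by a modification in the ball of radius `r`. -/
def smoothedKernel (r : ℝ) (w : ℍ[ℝ]) : ℍ[ℝ] :=
  ((2 * Real.pi ^ 2)⁻¹ * tangentProfile (r ^ 2) (‖w‖ ^ 2)) • star w

/-- The mean value density `6 / (π² r⁴) (1 - |w|² / r²)₊`. -/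
def meanDensity (r : ℝ) (w : ℍ[ℝ]) : ℝ :=
  6 * (Real.pi ^ 2)⁻¹ * r⁻¹ ^ 4 * max 0 (1 - ‖w‖ ^ 2 * r⁻¹ ^ 2)

theorem smoothedKernel_of_le (θ : ℝ) {r : ℝ} (hr : 0 < r) {w : ℍ[ℝ]} (h : r ≤ ‖w‖) :
    smoothedKernel r w = cauchyKernel θ w := by
  rw [cauchyKernel_eq, smoothedKernel, tangentProfile_of_le (by positivity) (by gcongr)]
  congr 1
  have : ‖w‖ ≠ 0 := (hr.trans_le h).ne'
  field_simp

theorem contDiff_smoothedKernel {r : ℝ} (hr : 0 < r) : ContDiff ℝ 1 (smoothedKernel r) := by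
  have h1 : ContDiff ℝ 1 fun w : ℍ[ℝ] => tangentProfile (r ^ 2) (‖w‖ ^ 2) :=
    (contDiff_tangentProfile (by positivity)).comp (contDiff_norm_sq ℝ)
  have h2 : ContDiff ℝ 1 fun w : ℍ[ℝ] => star w :=
    starCLM.contDiff
  exact (contDiff_const.mul h1).smul h2

theorem fderiv_smoothedKernel {r : ℝ} (hr : 0 < r) (w a : ℍ[ℝ]) :
    fderiv ℝ (smoothedKernel r) w a =
      ((2 * Real.pi ^ 2)⁻¹ * tangentProfile (r ^ 2) (‖w‖ ^ 2)) • star a +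
      ((2 * Real.pi ^ 2)⁻¹ * (tangentProfileDeriv (r ^ 2) (‖w‖ ^ 2) * (2 * inner ℝ w a))) •
        star w := by
  have h0 : HasFDerivAt (fun w : ℍ[ℝ] => ‖w‖ ^ 2) (2 • innerSL ℝ w) w :=
    (hasStrictFDerivAt_norm_sq w).hasFDerivAt
  have h1 : HasFDerivAt (fun w : ℍ[ℝ] => tangentProfile (r ^ 2) (‖w‖ ^ 2)) _ w :=
    (hasDerivAt_tangentProfile (by positivity : 0 < r ^ 2) (‖w‖ ^ 2)).comp_hasFDerivAt
      (f := fun w : ℍ[ℝ] => ‖w‖ ^ 2) w h0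
  have h2 : HasFDerivAt (fun w : ℍ[ℝ] => star w) starCLM w := starCLM.hasFDerivAt
  have h3 : HasFDerivAt (smoothedKernel r) _ w := (h1.const_mul ((2 * Real.pi ^ 2)⁻¹)).fun_smul h2
  rw [h3.fderiv]
  simp [starCLM_apply]

/-- For a kernel `φ(|w|²) conj w` the right side is the divergence `4φ + 2φ'|w|²`. It vanishes for
the profile `t⁻²`, and the tangent line turns it into the truncated paraboloid inside the ball. -/
theorem meanDensity_eq {r : ℝ} (hr : 0 < r) (w : ℍ[ℝ]) :
    meanDensity r w = 4 * ((2 * Real.pi ^ 2)⁻¹ * tangentProfile (r ^ 2) (‖w‖ ^ 2)) +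
      2 * ((2 * Real.pi ^ 2)⁻¹ * tangentProfileDeriv (r ^ 2) (‖w‖ ^ 2)) * ‖w‖ ^ 2 := by
  rcases le_total (‖w‖ ^ 2) (r ^ 2) with h | h
  · rw [meanDensity, tangentProfile, tangentProfileDeriv, if_pos h, max_eq_right h, max_eq_right]
    · field_simp
      ring
    · rw [sub_nonneg, inv_pow, ← div_eq_mul_inv]
      exact div_le_one_of_le₀ h (by positivity)
  · rw [meanDensity, tangentProfile_of_le (by positivity) h, tangentProfileDeriv_of_le h,
      max_eq_left]
    · have : ‖w‖ ≠ 0 := by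
        have h1 : 0 < r ^ 2 := by positivity
        have h2 := h1.trans_le h
        intro h0
        simp [h0] at h2
      field_simp
      ring
    · rw [sub_nonpos, inv_pow, ← div_eq_mul_inv, one_le_div (by positivity)]
      exact h

/-- The derivative of `φ(|w|²) conj w` along `ψ_k` is `φ conj ψ_k + 2φ' ⟨w, ψ_k⟩ conj w`. The sum
collapses by `conj ψ_k ψ_k = 1`, `∑ ⟨w, ψ_k⟩ ψ_k = w` and `conj w w = |w|²`. The result is real, and
therefore the same for multiplication from the other side. -/
theorem sum_fderiv_smoothedKernel_mul_psi (θ : ℝ) {r : ℝ} (hr : 0 < r) (w : ℍ[ℝ]) :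
    ∑ k, fderiv ℝ (smoothedKernel r) w (psi θ k) * psi θ k = (meanDensity r w : ℍ[ℝ]) := by
  have h1 : ∀ k, star (psi θ k) * psi θ k = 1 := fun k => by
    rw [star_mul_self_eq, norm_psi]; simp
  have h2 : ∑ k, (inner ℝ w (psi θ k) : ℝ) • psi θ k = w := by
    conv_rhs => rw [← sum_coord_smul_psi θ w]
    exact Finset.sum_congr rfl fun k _ => by rw [coord, real_inner_comm]
  simp only [fderiv_smoothedKernel hr, add_mul, smul_mul_assoc, h1]
  rw [Finset.sum_add_distrib]
  have h3 : ∀ c d : ℝ, ∑ k, (c * (d * (2 * inner ℝ w (psi θ k)))) • (star w * psi θ k) =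
      ((2 * (c * d) * ‖w‖ ^ 2 : ℝ) : ℍ[ℝ]) := by
    intro c d
    calc _ = (2 * (c * d)) • (star w * ∑ k, (inner ℝ w (psi θ k) : ℝ) • psi θ k) := by
          rw [Finset.mul_sum, Finset.smul_sum]
          refine Finset.sum_congr rfl fun k _ => ?_
          rw [mul_smul_comm, smul_smul]
          congr 1; ring
      _ = _ := by rw [h2, star_mul_self_eq, Quaternion.smul_coe]
  rw [h3, meanDensity_eq hr, Quaternion.coe_add, Finset.sum_const, Finset.card_univ,
    Fintype.card_fin, ← Nat.cast_smul_eq_nsmul ℝ, smul_smul, ← Quaternion.coe_one, Quaternion.smul_coe]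
  norm_num

theorem sum_psi_mul_fderiv_smoothedKernel (θ : ℝ) {r : ℝ} (hr : 0 < r) (w : ℍ[ℝ]) :
    ∑ k, psi θ k * fderiv ℝ (smoothedKernel r) w (psi θ k) = (meanDensity r w : ℍ[ℝ]) := by
  have h1 : ∀ k, psi θ k * star (psi θ k) = 1 := fun k => by
    rw [self_mul_star_eq, norm_psi]; simp
  have h2 : ∑ k, (inner ℝ w (psi θ k) : ℝ) • psi θ k = w := by
    conv_rhs => rw [← sum_coord_smul_psi θ w]
    exact Finset.sum_congr rfl fun k _ => by rw [coord, real_inner_comm]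
  simp only [fderiv_smoothedKernel hr, mul_add, mul_smul_comm, h1]
  rw [Finset.sum_add_distrib]
  have h3 : ∀ c d : ℝ, ∑ k, (c * (d * (2 * inner ℝ w (psi θ k)))) • (psi θ k * star w) =
      ((2 * (c * d) * ‖w‖ ^ 2 : ℝ) : ℍ[ℝ]) := by
    intro c d
    calc _ = (2 * (c * d)) • ((∑ k, (inner ℝ w (psi θ k) : ℝ) • psi θ k) * star w) := by
          rw [Finset.sum_mul, Finset.smul_sum]
          refine Finset.sum_congr rfl fun k _ => ?_
          rw [smul_mul_assoc, smul_smul]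
          congr 1; ring
      _ = _ := by rw [h2, self_mul_star_eq, Quaternion.smul_coe]
  rw [h3, meanDensity_eq hr, Quaternion.coe_add, Finset.sum_const, Finset.card_univ,
    Fintype.card_fin, ← Nat.cast_smul_eq_nsmul ℝ, smul_smul, ← Quaternion.coe_one, Quaternion.smul_coe]
  norm_num

theorem meanDensity_nonneg (r : ℝ) (w : ℍ[ℝ]) : 0 ≤ meanDensity r w := by
  unfold meanDensity
  have := le_max_left 0 (1 - ‖w‖ ^ 2 * r⁻¹ ^ 2)
  positivity

theorem meanDensity_le (r : ℝ) (w : ℍ[ℝ]) :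
    meanDensity r w ≤ 6 * (Real.pi ^ 2)⁻¹ * r⁻¹ ^ 4 := by
  unfold meanDensity
  refine mul_le_of_le_one_right (by positivity) (max_le zero_le_one ?_)
  have : 0 ≤ ‖w‖ ^ 2 * r⁻¹ ^ 2 := by positivity
  linarith

theorem continuous_meanDensity (r : ℝ) : Continuous (meanDensity r) := by
  unfold meanDensity
  fun_prop

theorem meanDensity_eq_zero {r : ℝ} (hr : 0 < r) {w : ℍ[ℝ]} (h : r ≤ ‖w‖) :
    meanDensity r w = 0 := by
  rw [meanDensity, max_eq_left, mul_zero]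
  rw [sub_nonpos, ← mul_pow]
  refine one_le_pow₀ ?_
  rw [← div_eq_mul_inv, one_le_div hr]
  exact h

/-- In polar coordinates the radial integral is `6/(π² r⁴) · (r⁴/4 - r⁴/6) = 1/(2π²)`, and the unit
sphere has area `4 · π²/2 = 2π²`. This fixes the constant of the Cauchy kernel. -/
theorem integral_meanDensity {r : ℝ} (hr : 0 < r) : ∫ w, meanDensity r w = 1 := by
  have hdim : Module.finrank ℝ ℍ[ℝ] = 4 := Quaternion.finrank_eq_four
  have h1 := integral_fun_norm_addHaar (volume : Measure ℍ[ℝ])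
    (fun t => 6 * (Real.pi ^ 2)⁻¹ * r⁻¹ ^ 4 * max 0 (1 - t ^ 2 * r⁻¹ ^ 2))
  have hball : volume.real (Metric.ball (0 : ℍ[ℝ]) 1) = Real.pi ^ 2 / 2 := by
    rw [Measure.real, InnerProductSpace.volume_ball_of_dim_even (k := 2) hdim, hdim,
      ENNReal.ofReal_one, one_pow, one_mul, ENNReal.toReal_ofReal (by positivity)]
    norm_num [Nat.factorial]
  have h2 : ∫ y in Set.Ioi (0 : ℝ), y ^ 3 • (6 * (Real.pi ^ 2)⁻¹ * r⁻¹ ^ 4 *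
      max 0 (1 - y ^ 2 * r⁻¹ ^ 2)) = (2 * Real.pi ^ 2)⁻¹ := by
    have h3 : ∫ y in Set.Ioi (0 : ℝ), y ^ 3 • (6 * (Real.pi ^ 2)⁻¹ * r⁻¹ ^ 4 *
      max 0 (1 - y ^ 2 * r⁻¹ ^ 2)) = ∫ y in Set.Ioc (0 : ℝ) r, y ^ 3 • (6 * (Real.pi ^ 2)⁻¹ *
        r⁻¹ ^ 4 * max 0 (1 - y ^ 2 * r⁻¹ ^ 2)) := by
      refine (setIntegral_eq_of_subset_of_forall_sdiff_eq_zero measurableSet_Ioi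
        Set.Ioc_subset_Ioi_self fun y hy => ?_)
      have hy1 : r < y := by
        by_contra hn
        exact hy.2 ⟨hy.1, not_lt.1 hn⟩
      rw [max_eq_left, mul_zero, smul_zero]
      rw [sub_nonpos, ← mul_pow]
      refine one_le_pow₀ ?_
      rw [← div_eq_mul_inv, one_le_div hr]
      exact hy1.le
    have h4 : ∫ y in Set.Ioc (0 : ℝ) r, y ^ 3 • (6 * (Real.pi ^ 2)⁻¹ *
        r⁻¹ ^ 4 * max 0 (1 - y ^ 2 * r⁻¹ ^ 2)) = ∫ y in Set.Ioc (0 : ℝ) r,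
        (6 * (Real.pi ^ 2)⁻¹ * r⁻¹ ^ 4 * y ^ 3 - 6 * (Real.pi ^ 2)⁻¹ * r⁻¹ ^ 6 * y ^ 5) := by
      refine setIntegral_congr_fun measurableSet_Ioc fun y hy => ?_
      simp only [smul_eq_mul]
      rw [max_eq_right]
      · ring
      · rw [sub_nonneg, ← mul_pow]
        refine pow_le_one₀ (mul_nonneg hy.1.le (by positivity)) ?_
        rw [← div_eq_mul_inv, div_le_one hr]
        exact hy.2
    rw [h3, h4, ← intervalIntegral.integral_of_le hr.le, intervalIntegral.integral_sub,
      intervalIntegral.integral_const_mul, intervalIntegral.integral_const_mul, integral_pow,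
      integral_pow]
    · field_simp
      ring
    · exact (Continuous.intervalIntegrable (by fun_prop) _ _)
    · exact (Continuous.intervalIntegrable (by fun_prop) _ _)
  rw [hdim, hball, show 4 - 1 = 3 from rfl, h2] at h1
  refine Eq.trans h1 ?_
  rw [nsmul_eq_mul, smul_eq_mul]
  have := Real.pi_ne_zero
  field_simp
  norm_num

/-! ### The exponential weight and the Cauchy field -/

/-- The exponential weight `e^{⟨u, ζ - z⟩}`. -/
def expWeight (u z ζ : ℍ[ℝ]) : ℝ := Real.exp (inner ℝ u (ζ - z))

theorem contDiff_expWeight (u z : ℍ[ℝ]) : ContDiff ℝ 1 (expWeight u z) :=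
  (contDiff_const.inner ℝ (contDiff_id.sub contDiff_const)).exp

theorem hasFDerivAt_expWeight (u z ζ : ℍ[ℝ]) :
    HasFDerivAt (expWeight u z) (expWeight u z ζ • innerSL ℝ u) ζ := by
  have h1 : HasFDerivAt (fun ζ : ℍ[ℝ] => innerSL ℝ u (ζ - z)) (innerSL ℝ u) ζ :=
    (innerSL ℝ u).hasFDerivAt.comp ζ ((hasFDerivAt_id ζ).sub_const z)
  exact h1.exp

theorem expWeight_self (u z : ℍ[ℝ]) : expWeight u z z = 1 := by simp [expWeight]

theorem expWeight_pos (u z ζ : ℍ[ℝ]) : 0 < expWeight u z ζ := Real.exp_pos _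

theorem expWeight_le {u z ζ : ℍ[ℝ]} {r : ℝ} (h : ‖ζ - z‖ ≤ r) :
    expWeight u z ζ ≤ Real.exp (‖u‖ * r) := by
  refine Real.exp_le_exp.2 ((real_inner_le_norm _ _).trans ?_)
  gcongr

theorem sum_inner_smul_psi (θ : ℝ) (u : ℍ[ℝ]) :
    ∑ k, (inner ℝ u (psi θ k) : ℝ) • psi θ k = u := by
  conv_rhs => rw [← sum_coord_smul_psi θ u]
  exact Finset.sum_congr rfl fun k _ => by rw [coord, real_inner_comm]

theorem fderiv_expWeight_smul {u z ζ : ℍ[ℝ]} {f : ℍ[ℝ] → ℍ[ℝ]} (hf : DifferentiableAt ℝ f ζ)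
    (a : ℍ[ℝ]) : fderiv ℝ (fun ζ => expWeight u z ζ • f ζ) ζ a =
      expWeight u z ζ • (fderiv ℝ f ζ a + (inner ℝ u a : ℝ) • f ζ) := by
  rw [((hasFDerivAt_expWeight u z ζ).fun_smul hf.hasFDerivAt).fderiv]
  simp [smul_add, smul_smul]

/-- The exponential weight turns left `(θ, u)`-hyperholomorphic functions into functions in the
kernel of `∑ ψ_k ∂/∂x_k`. -/
theorem sum_psi_mul_fderiv_expWeight_smul {θ : ℝ} {u z ζ : ℍ[ℝ]} {Ω : Set ℍ[ℝ]} (hΩ : IsOpen Ω)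
    {f : ℍ[ℝ] → ℍ[ℝ]} (hf : LeftHyperholomorphic θ u Ω f) (hζ : ζ ∈ Ω) :
    ∑ k, psi θ k * fderiv ℝ (fun ζ => expWeight u z ζ • f ζ) ζ (psi θ k) = 0 := by
  have hd := (hf.1.contDiffAt (hΩ.mem_nhds hζ)).differentiableAt one_ne_zero
  have h0 := hf.2 ζ hζ
  simp only [fderiv_expWeight_smul hd, mul_smul_comm, mul_add]
  rw [← Finset.smul_sum, Finset.sum_add_distrib]
  have : ∑ k, (inner ℝ u (psi θ k) : ℝ) • (psi θ k * f ζ) = u * f ζ := by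
    conv_rhs => rw [← sum_inner_smul_psi θ u, Finset.sum_mul]
    simp only [smul_mul_assoc]
  rw [this]
  exact (congrArg _ h0).trans (smul_zero _)

theorem sum_fderiv_expWeight_smul_mul_psi {θ : ℝ} {u z ζ : ℍ[ℝ]} {Ω : Set ℍ[ℝ]} (hΩ : IsOpen Ω)
    {g : ℍ[ℝ] → ℍ[ℝ]} (hg : RightHyperholomorphic θ u Ω g) (hζ : ζ ∈ Ω) :
    ∑ k, fderiv ℝ (fun ζ => expWeight u z ζ • g ζ) ζ (psi θ k) * psi θ k = 0 := by
  have hd := (hg.1.contDiffAt (hΩ.mem_nhds hζ)).differentiableAt one_ne_zero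
  have h0 := hg.2 ζ hζ
  simp only [fderiv_expWeight_smul hd, smul_mul_assoc, add_mul]
  rw [← Finset.smul_sum, Finset.sum_add_distrib]
  have : ∑ k, (inner ℝ u (psi θ k) : ℝ) • (g ζ * psi θ k) = g ζ * u := by
    conv_rhs => rw [← sum_inner_smul_psi θ u, Finset.mul_sum]
    simp only [mul_smul_comm]
  rw [this]
  exact (congrArg _ h0).trans (smul_zero _)

/-- The field whose flux through the boundary is the Cauchy integral. -/
def cauchyField (θ r : ℝ) (u : ℍ[ℝ]) (f g : ℍ[ℝ] → ℍ[ℝ]) (z : ℍ[ℝ]) (k : Fin 4) (ζ : ℍ[ℝ]) :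
    ℍ[ℝ] :=
  smoothedKernel r (ζ - z) * psi θ k * (expWeight u z ζ • f ζ) +
    (expWeight u z ζ • g ζ) * psi θ k * smoothedKernel r (ζ - z)

/-- At distance at least `r` from `z` the smoothing changes nothing. The exponential factor of the
kernel is real, so it can be moved onto `f` and `g`. -/
theorem cauchyIntegrand_eq (θ : ℝ) {r : ℝ} (hr : 0 < r) (u : ℍ[ℝ]) (Ω : Set ℍ[ℝ])
    (f g : ℍ[ℝ] → ℍ[ℝ]) {z ζ : ℍ[ℝ]} (h : r ≤ ‖ζ - z‖) :
    cauchyIntegrand θ u Ω f g z ζ =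
      ∑ k, (inner ℝ (psi θ k) (outwardNormal Ω ζ) : ℝ) • cauchyField θ r u f g z k ζ := by
  have h1 : cauchyKernelU θ u (ζ - z) = expWeight u z ζ • smoothedKernel r (ζ - z) := by
    rw [cauchyKernelU, smoothedKernel_of_le θ hr h, thetaInner_eq_inner, expWeight]
  rw [cauchyIntegrand, h1]
  simp only [cauchyField, smul_add, areaForm, Finset.mul_sum, Finset.sum_mul,
    Finset.sum_add_distrib, mul_smul_comm, smul_mul_assoc, coord]
  rw [Finset.smul_sum]
  congr 1
  refine Finset.sum_congr rfl fun k _ => ?_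
  rw [smul_comm]

theorem continuousOn_cauchyField (θ : ℝ) {r : ℝ} (hr : 0 < r) (u z : ℍ[ℝ]) {f g : ℍ[ℝ] → ℍ[ℝ]}
    {s : Set ℍ[ℝ]} (hf : ContinuousOn f s) (hg : ContinuousOn g s) (k : Fin 4) :
    ContinuousOn (cauchyField θ r u f g z k) s := by
  have h1 : Continuous fun ζ : ℍ[ℝ] => smoothedKernel r (ζ - z) :=
    (contDiff_smoothedKernel hr).continuous.comp (continuous_id.sub continuous_const)
  have h2 := (contDiff_expWeight u z).continuous
  exact ((h1.continuousOn.mul continuousOn_const).mul (h2.continuousOn.smul hf)).add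
    (((h2.continuousOn.smul hg).mul continuousOn_const).mul h1.continuousOn)

theorem contDiffOn_cauchyField (θ : ℝ) {r : ℝ} (hr : 0 < r) (u z : ℍ[ℝ]) {f g : ℍ[ℝ] → ℍ[ℝ]}
    {s : Set ℍ[ℝ]} (hf : ContDiffOn ℝ 1 f s) (hg : ContDiffOn ℝ 1 g s) (k : Fin 4) :
    ContDiffOn ℝ 1 (cauchyField θ r u f g z k) s := by
  have h1 : ContDiff ℝ 1 fun ζ : ℍ[ℝ] => smoothedKernel r (ζ - z) :=
    (contDiff_smoothedKernel hr).comp (contDiff_id.sub contDiff_const)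
  have h2 := contDiff_expWeight u z
  exact ((h1.contDiffOn.mul contDiffOn_const).mul (h2.contDiffOn.smul hf)).add
    (((h2.contDiffOn.smul hg).mul contDiffOn_const).mul h1.contDiffOn)

/-- In the product rule the derivatives of the weighted `f` and `g` cancel after summation, since
they solve the unweighted equations. What remains is the divergence of the kernel, which is real and
hence commutes with the values. -/
theorem sum_fderiv_cauchyField {θ r : ℝ} (hr : 0 < r) {u z ζ : ℍ[ℝ]} {Ω : Set ℍ[ℝ]}
    (hΩ : IsOpen Ω) {f g : ℍ[ℝ] → ℍ[ℝ]} (hf : LeftHyperholomorphic θ u Ω f)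
    (hg : RightHyperholomorphic θ u Ω g) (hζ : ζ ∈ Ω) :
    ∑ k, fderiv ℝ (cauchyField θ r u f g z k) ζ (psi θ k) =
      meanDensity r (ζ - z) • (expWeight u z ζ • (f ζ + g ζ)) := by
  set K : ℍ[ℝ] → ℍ[ℝ] := fun ζ => smoothedKernel r (ζ - z) with hK
  set P : ℍ[ℝ] → ℍ[ℝ] := fun ζ => expWeight u z ζ • f ζ with hP
  set Q : ℍ[ℝ] → ℍ[ℝ] := fun ζ => expWeight u z ζ • g ζ with hQ
  have hKd : HasFDerivAt K (fderiv ℝ (smoothedKernel r) (ζ - z)) ζ :=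
    HasFDerivAt.comp (g := smoothedKernel r) (f := fun ζ : ℍ[ℝ] => ζ - z) ζ
      ((contDiff_smoothedKernel hr).differentiable one_ne_zero (ζ - z)).hasFDerivAt
      ((hasFDerivAt_id ζ).sub_const z)
  have hEd := (contDiff_expWeight u z).differentiable one_ne_zero ζ
  have hPd : HasFDerivAt P (fderiv ℝ P ζ) ζ := (hEd.smul
    ((hf.1.contDiffAt (hΩ.mem_nhds hζ)).differentiableAt one_ne_zero)).hasFDerivAt
  have hQd : HasFDerivAt Q (fderiv ℝ Q ζ) ζ := (hEd.smul
    ((hg.1.contDiffAt (hΩ.mem_nhds hζ)).differentiableAt one_ne_zero)).hasFDerivAt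
  have hd : ∀ k, fderiv ℝ (cauchyField θ r u f g z k) ζ (psi θ k) =
      fderiv ℝ (smoothedKernel r) (ζ - z) (psi θ k) * psi θ k * P ζ +
      K ζ * (psi θ k * fderiv ℝ P ζ (psi θ k)) +
      (fderiv ℝ Q ζ (psi θ k) * psi θ k * K ζ +
      Q ζ * (psi θ k * fderiv ℝ (smoothedKernel r) (ζ - z) (psi θ k))) := by
    intro k
    have h1 := ((hKd.mul_const' (psi θ k)).mul' hPd).add ((hQd.mul_const' (psi θ k)).mul' hKd)
    have h2 : HasFDerivAt (cauchyField θ r u f g z k) _ ζ := h1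
    rw [h2.fderiv]
    simp [mul_assoc]
    abel
  simp only [hd, Finset.sum_add_distrib, ← Finset.mul_sum, ← Finset.sum_mul]
  rw [sum_fderiv_smoothedKernel_mul_psi θ hr, sum_psi_mul_fderiv_smoothedKernel θ hr, hP, hQ,
    sum_psi_mul_fderiv_expWeight_smul hΩ hf hζ, sum_fderiv_expWeight_smul_mul_psi hΩ hg hζ,
    Quaternion.coe_mul_eq_smul, Quaternion.mul_coe_eq_smul]
  simp [smul_add]

/-- The Cauchy integral as a mean value with density `meanDensity`. -/
theorem integral_cauchyIntegrand_eq {θ r : ℝ} (hr : 0 < r) {u z : ℍ[ℝ]} {Ω : Set ℍ[ℝ]}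
    (hΩ : IsOpen Ω) (hb : Bornology.IsBounded Ω) (hC : HasC1Boundary Ω) {f g : ℍ[ℝ] → ℍ[ℝ]}
    (hf : LeftHyperholomorphic θ u Ω f) (hfc : ContinuousOn f (closure Ω))
    (hg : RightHyperholomorphic θ u Ω g) (hgc : ContinuousOn g (closure Ω))
    (hz : ∀ ζ ∈ frontier Ω, r ≤ ‖ζ - z‖) :
    Integrable (cauchyIntegrand θ u Ω f g z) (surfaceMeasure Ω) ∧
    ∫ ζ, cauchyIntegrand θ u Ω f g z ζ ∂(surfaceMeasure Ω) =
      ∫ ζ in Ω, meanDensity r (ζ - z) • (expWeight u z ζ • (f ζ + g ζ)) := by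
  have hae : cauchyIntegrand θ u Ω f g z =ᵐ[surfaceMeasure Ω] fun ζ =>
      ∑ k, (inner ℝ (psi θ k) (outwardNormal Ω ζ) : ℝ) • cauchyField θ r u f g z k ζ := by
    filter_upwards [ae_mem_frontier_surfaceMeasure Ω] with ζ hζ
    exact cauchyIntegrand_eq θ hr u Ω f g (hz ζ hζ)
  refine ⟨Integrable.congr (integrable_surfaceMeasure hb hC ?_) hae.symm, ?_⟩
  · exact continuousOn_finsetSum _ fun k _ =>
      (continuousOn_const.inner (𝕜 := ℝ) (continuousOn_outwardNormal hC)).smul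
        ((continuousOn_cauchyField θ hr u z hfc hgc k).mono frontier_subset_closure)
  · rw [integral_congr_ae hae]
    refine divergence_theorem hΩ hb hC (psi θ)
      (fun k => continuousOn_cauchyField θ hr u z hfc hgc k)
      (fun k => contDiffOn_cauchyField θ hr u z hf.1 hg.1 k) ?_
      (fun ζ hζ => sum_fderiv_cauchyField hr hΩ hf hg hζ)
    exact ((continuous_meanDensity r).comp
      (continuous_id.sub continuous_const)).continuousOn.smul
      ((contDiff_expWeight u z).continuous.continuousOn.smul (hfc.add hgc))

/-! ### Approximate identity and the Cauchy formula -/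

theorem integral_meanDensity_sub {r : ℝ} (hr : 0 < r) (z : ℍ[ℝ]) :
    ∫ ζ, meanDensity r (ζ - z) = 1 := by
  rw [integral_sub_right_eq_self (fun w => meanDensity r w) z, integral_meanDensity hr]

theorem integrable_meanDensity_sub {r : ℝ} (hr : 0 < r) (z : ℍ[ℝ]) :
    Integrable fun ζ => meanDensity r (ζ - z) := by
  -- The integral of a non-integrable function is `0` by convention, while this one is `1`.
  by_contra h
  have := integral_meanDensity_sub hr z
  rw [integral_undef h] at this
  exact zero_ne_one this

theorem setIntegral_meanDensity_sub {r : ℝ} (hr : 0 < r) {z : ℍ[ℝ]} {Ω : Set ℍ[ℝ]}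
    (h : Metric.ball z r ⊆ Ω) : ∫ ζ in Ω, meanDensity r (ζ - z) = 1 := by
  rw [← integral_meanDensity_sub hr z]
  refine setIntegral_eq_integral_of_forall_compl_eq_zero fun ζ hζ => meanDensity_eq_zero hr ?_
  by_contra hn
  refine hζ (h ?_)
  rw [Metric.mem_ball, dist_eq_norm]
  exact not_le.1 hn

theorem norm_setIntegral_meanDensity_smul_sub_le {r : ℝ} (hr : 0 < r) {z : ℍ[ℝ]} {Ω : Set ℍ[ℝ]}
    (hb : Metric.ball z r ⊆ Ω) {Φ : ℍ[ℝ] → ℍ[ℝ]} {c : ℍ[ℝ]} {η : ℝ}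
    (hΦ : ∀ ζ ∈ Metric.ball z r, ‖Φ ζ - c‖ ≤ η)
    (hi : IntegrableOn (fun ζ => meanDensity r (ζ - z) • Φ ζ) Ω) :
    ‖(∫ ζ in Ω, meanDensity r (ζ - z) • Φ ζ) - c‖ ≤ η := by
  have hmi := (integrable_meanDensity_sub hr z).integrableOn (s := Ω)
  have h1 : (∫ ζ in Ω, meanDensity r (ζ - z) • c) = c := by
    rw [integral_smul_const, setIntegral_meanDensity_sub hr hb, one_smul]
  have h2 : (∫ ζ in Ω, meanDensity r (ζ - z) * η) = η := by
    rw [integral_mul_const, setIntegral_meanDensity_sub hr hb, one_mul]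
  conv_lhs => rw [← h1]
  conv_rhs => rw [← h2]
  rw [← integral_sub hi (hmi.smul_const c)]
  refine norm_integral_le_of_norm_le (hmi.mul_const η) (Filter.Eventually.of_forall fun ζ => ?_)
  rw [← smul_sub, norm_smul, Real.norm_eq_abs, abs_of_nonneg (meanDensity_nonneg r _)]
  by_cases hζ : ζ ∈ Metric.ball z r
  · exact mul_le_mul_of_nonneg_left (hΦ ζ hζ) (meanDensity_nonneg r _)
  · rw [Metric.mem_ball, dist_eq_norm, not_lt] at hζ
    rw [meanDensity_eq_zero hr hζ, zero_mul, zero_mul]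

theorem exists_ball_disjoint_frontier {Ω : Set ℍ[ℝ]} {z : ℍ[ℝ]} (hz : z ∉ frontier Ω) :
    ∃ r > 0, ∀ ζ ∈ frontier Ω, r ≤ ‖ζ - z‖ := by
  obtain ⟨r, hr, h⟩ := Metric.isOpen_iff.1 isClosed_frontier.isOpen_compl z hz
  refine ⟨r, hr, fun ζ hζ => ?_⟩
  by_contra hn
  refine h (?_ : ζ ∈ Metric.ball z r) hζ
  rw [Metric.mem_ball, dist_eq_norm]
  exact not_le.1 hn

/-- The surface integral does not depend on `r`, whereas its expression as a mean value concentrates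
at `z` as `r` shrinks, where the weight is `1`. Continuity of the weighted sum at `z` then gives the
value within any `η`. -/
theorem integral_cauchyIntegrand_of_mem {θ : ℝ} {u z : ℍ[ℝ]} {Ω : Set ℍ[ℝ]}
    (hΩ : IsOpen Ω) (hb : Bornology.IsBounded Ω) (hC : HasC1Boundary Ω) {f g : ℍ[ℝ] → ℍ[ℝ]}
    (hf : LeftHyperholomorphic θ u Ω f) (hfc : ContinuousOn f (closure Ω))
    (hg : RightHyperholomorphic θ u Ω g) (hgc : ContinuousOn g (closure Ω)) (hz : z ∈ Ω) :
    ∫ ζ, cauchyIntegrand θ u Ω f g z ζ ∂(surfaceMeasure Ω) = f z + g z := by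
  have hzf : z ∉ frontier Ω := by rw [hΩ.frontier_eq]; exact fun h => h.2 hz
  obtain ⟨r₀, hr₀, hr₀f⟩ := exists_ball_disjoint_frontier hzf
  obtain ⟨r₁, hr₁, hr₁Ω⟩ := Metric.isOpen_iff.1 hΩ z hz
  have hΦ : ContinuousOn (fun ζ => expWeight u z ζ • (f ζ + g ζ)) (closure Ω) :=
    (contDiff_expWeight u z).continuous.continuousOn.smul (hfc.add hgc)
  have hΦz := (hΦ.mono subset_closure).continuousAt (hΩ.mem_nhds hz)
  rw [← sub_eq_zero, ← norm_le_zero_iff]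
  refine le_of_forall_pos_le_add fun η hη => ?_
  rw [zero_add]
  obtain ⟨r₂, hr₂, hr₂Φ⟩ := Metric.continuousAt_iff.1 hΦz η hη
  set r := min r₀ (min r₁ r₂)
  have hr : 0 < r := lt_min hr₀ (lt_min hr₁ hr₂)
  rw [(integral_cauchyIntegrand_eq hr hΩ hb hC hf hfc hg hgc
    fun ζ hζ => (min_le_left _ _).trans (hr₀f ζ hζ)).2]
  refine norm_setIntegral_meanDensity_smul_sub_le hr
    ((Metric.ball_subset_ball ((min_le_right _ _).trans (min_le_left _ _))).trans hr₁Ω)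
    (fun ζ hζ => ?_) ?_
  · have h1 := hr₂Φ (Metric.ball_subset_ball ((min_le_right _ _).trans (min_le_right _ _)) hζ)
    rw [expWeight_self, one_smul, dist_eq_norm] at h1
    exact h1.le
  · have : ContinuousOn (fun ζ => meanDensity r (ζ - z) • (expWeight u z ζ • (f ζ + g ζ)))
        (closure Ω) := ((continuous_meanDensity r).comp
      (continuous_id.sub continuous_const)).continuousOn.smul hΦ
    exact (this.integrableOn_compact hb.isCompact_closure).mono_set subset_closure

/-- For `r` below the distance from `z` to the closure, the mean value density vanishes on all of
`Ω`. -/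
theorem integral_cauchyIntegrand_of_notMem {θ : ℝ} {u z : ℍ[ℝ]} {Ω : Set ℍ[ℝ]}
    (hΩ : IsOpen Ω) (hb : Bornology.IsBounded Ω) (hC : HasC1Boundary Ω) {f g : ℍ[ℝ] → ℍ[ℝ]}
    (hf : LeftHyperholomorphic θ u Ω f) (hfc : ContinuousOn f (closure Ω))
    (hg : RightHyperholomorphic θ u Ω g) (hgc : ContinuousOn g (closure Ω))
    (hz : z ∉ closure Ω) :
    ∫ ζ, cauchyIntegrand θ u Ω f g z ζ ∂(surfaceMeasure Ω) = 0 := by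
  obtain ⟨r, hr, h⟩ := Metric.isOpen_iff.1 isClosed_closure.isOpen_compl z hz
  have hle : ∀ ζ ∈ closure Ω, r ≤ ‖ζ - z‖ := by
    intro ζ hζ
    by_contra hn
    refine h (?_ : ζ ∈ Metric.ball z r) hζ
    rw [Metric.mem_ball, dist_eq_norm]
    exact not_le.1 hn
  rw [(integral_cauchyIntegrand_eq hr hΩ hb hC hf hfc hg hgc
    fun ζ hζ => hle ζ (frontier_subset_closure hζ)).2]
  refine setIntegral_eq_zero_of_forall_eq_zero fun ζ hζ => ?_
  rw [meanDensity_eq_zero hr (hle ζ (subset_closure hζ)), zero_smul]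

/-! ### Balls and the L² estimate -/

theorem hasC1Boundary_ball (z : ℍ[ℝ]) {r : ℝ} (hr : 0 < r) : HasC1Boundary (Metric.ball z r) := by
  intro p hp
  rw [frontier_ball z hr.ne', Metric.mem_sphere, dist_eq_norm] at hp
  have h1 : HasFDerivAt (fun x : ℍ[ℝ] => ‖x - z‖ ^ 2 - r ^ 2) (2 • innerSL ℝ (p - z)) p := by
    have := ((hasStrictFDerivAt_norm_sq (p - z)).hasFDerivAt.comp p
      ((hasFDerivAt_id p).sub_const z)).sub_const (r ^ 2)
    simpa using this
  refine ⟨fun x => ‖x - z‖ ^ 2 - r ^ 2, ?_, ?_, ?_⟩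
  · exact (((contDiff_id.sub contDiff_const).norm_sq ℝ).sub contDiff_const).contDiffAt
  · rw [h1.fderiv]
    intro h0
    have h2 : (2 • innerSL ℝ (p - z)) (p - z) = 2 * r ^ 2 := by
      rw [smul_apply, innerSL_apply_apply, real_inner_self_eq_norm_sq, hp]
      simp
    rw [h0, zero_apply] at h2
    have : 0 < r ^ 2 := by positivity
    linarith
  · refine Filter.Eventually.of_forall fun x => ?_
    rw [Metric.mem_ball, dist_eq_norm, sub_neg, sq_lt_sq₀ (norm_nonneg _) hr.le]

theorem LeftHyperholomorphic.mono {θ : ℝ} {u : ℍ[ℝ]} {Ω Ω' : Set ℍ[ℝ]} {f : ℍ[ℝ] → ℍ[ℝ]}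
    (hf : LeftHyperholomorphic θ u Ω f) (h : Ω' ⊆ Ω) : LeftHyperholomorphic θ u Ω' f :=
  ⟨hf.1.mono h, fun z hz => hf.2 z (h hz)⟩

theorem rightHyperholomorphic_zero (θ : ℝ) (u : ℍ[ℝ]) (Ω : Set ℍ[ℝ]) :
    RightHyperholomorphic θ u Ω 0 := by
  refine ⟨contDiffOn_const, fun z _ => ?_⟩
  simp [rightOp, partialD]

theorem setIntegral_norm_le_sqrt {α : Type*} [MeasurableSpace α] {μ : Measure α} {s : Set α}
    (hs : μ s ≠ ⊤) {f : α → ℍ[ℝ]} (hf : MemLp f 2 (μ.restrict s)) :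
    ∫ x in s, ‖f x‖ ∂μ ≤ (μ.real s) ^ (1 / 2 : ℝ) * (∫ x in s, ‖f x‖ ^ 2 ∂μ) ^ (1 / 2 : ℝ) := by
  have : IsFiniteMeasure (μ.restrict s) := ⟨by simpa using hs.lt_top⟩
  have h := integral_mul_le_Lp_mul_Lq_of_nonneg (μ := μ.restrict s) (p := 2) (q := 2)
    (f := fun _ => (1 : ℝ)) (g := fun x => ‖f x‖) Real.HolderConjugate.two_two
    (Filter.Eventually.of_forall fun _ => zero_le_one)
    (Filter.Eventually.of_forall fun _ => norm_nonneg _) (memLp_const 1)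
    (by simpa using hf.norm)
  simpa using h

/-- Mean value estimate for left hyperholomorphic functions. -/
theorem norm_le_of_leftHyperholomorphic {θ ε : ℝ} (hε : 0 < ε) {u z : ℍ[ℝ]} {Ω : Set ℍ[ℝ]}
    (hB : closure (Metric.ball z ε) ⊆ Ω) {f : ℍ[ℝ] → ℍ[ℝ]} (hf : LeftHyperholomorphic θ u Ω f) :
    ‖f z‖ ≤ 6 * (Real.pi ^ 2)⁻¹ * ε⁻¹ ^ 4 * Real.exp (‖u‖ * ε) *
      ((volume.real (Metric.ball (0 : ℍ[ℝ]) ε)) ^ (1 / 2 : ℝ) *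
      (∫ ζ in Metric.ball z ε, ‖f ζ‖ ^ 2) ^ (1 / 2 : ℝ)) := by
  have hfB := hf.mono (subset_closure.trans hB)
  have hfc : ContinuousOn f (closure (Metric.ball z ε)) := hf.1.continuousOn.mono hB
  have hC := hasC1Boundary_ball z hε
  have hb : Bornology.IsBounded (Metric.ball z ε) := Metric.isBounded_ball
  have hg := rightHyperholomorphic_zero θ u (Metric.ball z ε)
  have hgc : ContinuousOn (0 : ℍ[ℝ] → ℍ[ℝ]) (closure (Metric.ball z ε)) := continuousOn_const
  -- The same surface integral is evaluated twice: by the Cauchy formula with `g = 0`, and as a mean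
  -- value with the largest admissible radius `r = ε`, for which the sphere is at distance exactly
  -- `r` from its centre.
  have hmean : f z = ∫ ζ in Metric.ball z ε, meanDensity ε (ζ - z) • (expWeight u z ζ • f ζ) := by
    have h1 := integral_cauchyIntegrand_of_mem Metric.isOpen_ball hb hC hfB hfc hg hgc
      (Metric.mem_ball_self hε)
    rw [(integral_cauchyIntegrand_eq hε Metric.isOpen_ball hb hC hfB hfc hg hgc
      fun ζ hζ => ?_).2] at h1
    · simpa using h1.symm
    · rw [frontier_ball z hε.ne', Metric.mem_sphere, dist_eq_norm] at hζ
      exact hζ.ge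
  have hcomp : IsCompact (closure (Metric.ball z ε)) := hb.isCompact_closure
  have hi : IntegrableOn (fun ζ => ‖f ζ‖) (Metric.ball z ε) :=
    (hfc.norm.integrableOn_compact hcomp).mono_set subset_closure
  have hfin : volume (Metric.ball z ε) ≠ ⊤ := measure_ball_lt_top.ne
  have hL2 : MemLp f 2 (volume.restrict (Metric.ball z ε)) := by
    have : IsFiniteMeasure (volume.restrict (Metric.ball z ε)) := ⟨by simpa using hfin.lt_top⟩
    obtain ⟨C, hCb⟩ := hcomp.exists_bound_of_continuousOn hfc
    refine MemLp.of_bound ((hfc.mono subset_closure).aestronglyMeasurable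
      measurableSet_ball) C ?_
    filter_upwards [ae_restrict_mem measurableSet_ball] with ζ hζ using hCb ζ (subset_closure hζ)
  have hvol : volume.real (Metric.ball (0 : ℍ[ℝ]) ε) = volume.real (Metric.ball z ε) :=
    congrArg ENNReal.toReal (Measure.addHaar_ball_center volume z ε).symm
  rw [hvol]
  calc ‖f z‖ ≤ ∫ ζ in Metric.ball z ε,
        6 * (Real.pi ^ 2)⁻¹ * ε⁻¹ ^ 4 * Real.exp (‖u‖ * ε) * ‖f ζ‖ := by
        rw [hmean]
        refine norm_integral_le_of_norm_le (hi.const_mul _) ?_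
        filter_upwards [ae_restrict_mem measurableSet_ball] with ζ hζ
        rw [Metric.mem_ball, dist_eq_norm] at hζ
        rw [norm_smul, norm_smul, Real.norm_eq_abs, Real.norm_eq_abs,
          abs_of_nonneg (meanDensity_nonneg _ _), abs_of_nonneg (expWeight_pos u z ζ).le,
          mul_assoc _ _ ‖f ζ‖]
        gcongr
        · exact mul_nonneg (expWeight_pos u z ζ).le (norm_nonneg _)
        · exact meanDensity_le _ _
        · exact expWeight_le hζ.le
    _ = 6 * (Real.pi ^ 2)⁻¹ * ε⁻¹ ^ 4 * Real.exp (‖u‖ * ε) * ∫ ζ in Metric.ball z ε, ‖f ζ‖ :=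
        integral_const_mul _ _
    _ ≤ _ := by
        gcongr
        exact setIntegral_norm_le_sqrt hfin hL2

end ThetaHyper

end

theorem proposition3p8 (θ : ℝ) (hθ : θ ∈ Set.Ico 0 (2 * Real.pi)) (u : ℍ[ℝ]) :
    (∀ Ω : Set ℍ[ℝ], ThetaHyper.IsBoundedDomain Ω → ThetaHyper.HasC1Boundary Ω →
      ∀ f g : ℍ[ℝ] → ℍ[ℝ],
        ThetaHyper.LeftHyperholomorphic θ u Ω f → ContinuousOn f (closure Ω) →
        ThetaHyper.RightHyperholomorphic θ u Ω g → ContinuousOn g (closure Ω) →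
        ∀ z : ℍ[ℝ], z ∉ frontier Ω →
          Integrable (ThetaHyper.cauchyIntegrand θ u Ω f g z) (ThetaHyper.surfaceMeasure Ω) ∧
          (z ∈ Ω →
            ∫ ζ, ThetaHyper.cauchyIntegrand θ u Ω f g z ζ ∂(ThetaHyper.surfaceMeasure Ω)
              = f z + g z) ∧
          (z ∉ closure Ω →
            ∫ ζ, ThetaHyper.cauchyIntegrand θ u Ω f g z ζ ∂(ThetaHyper.surfaceMeasure Ω)
              = 0)) ∧
    (∀ ε : ℝ, 0 < ε → ∃ k : ℝ, 0 < k ∧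
      ∀ Ω : Set ℍ[ℝ], ThetaHyper.IsBoundedDomain Ω →
        ∀ z ∈ Ω, closure (Metric.ball z ε) ⊆ Ω →
          ∀ f : ℍ[ℝ] → ℍ[ℝ], ThetaHyper.LeftHyperholomorphic θ u Ω f →
            ‖f z‖ ≤ k * (∫ ζ in Metric.ball z ε, ‖f ζ‖ ^ 2) ^ (1 / 2 : ℝ)) := by
  -- The constant is the maximum of the density, times a bound for the exponential weight on the
  -- ball, times the Cauchy-Schwarz factor. The volume is taken for the ball at the origin, so the
  -- constant does not depend on `z`.
  refine ⟨fun Ω hΩ hC f g hf hfc hg hgc z hz => ⟨?_, fun hzΩ => ?_, fun hzΩ => ?_⟩,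
    fun ε hε => ⟨6 * (Real.pi ^ 2)⁻¹ * ε⁻¹ ^ 4 * Real.exp (‖u‖ * ε) *
      (volume.real (Metric.ball (0 : ℍ[ℝ]) ε)) ^ (1 / 2 : ℝ), ?_, fun Ω _ z _ hB f hf => ?_⟩⟩
  · obtain ⟨r, hr, h⟩ := ThetaHyper.exists_ball_disjoint_frontier hz
    exact (ThetaHyper.integral_cauchyIntegrand_eq hr hΩ.1 hΩ.2.2 hC hf hfc hg hgc h).1
  · exact ThetaHyper.integral_cauchyIntegrand_of_mem hΩ.1 hΩ.2.2 hC hf hfc hg hgc hzΩ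
  · exact ThetaHyper.integral_cauchyIntegrand_of_notMem hΩ.1 hΩ.2.2 hC hf hfc hg hgc hzΩ
  · have : 0 < volume.real (Metric.ball (0 : ℍ[ℝ]) ε) :=
      ENNReal.toReal_pos (Metric.measure_ball_pos _ _ hε).ne' measure_ball_lt_top.ne
    positivity
  · rw [mul_assoc]
    exact ThetaHyper.norm_le_of_leftHyperholomorphic hε hB hf
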